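/- Let $r>0$ and put $\rho=\log\frac{r}{2\sqrt2}$. For complex $\nu$ let $I_\nu(r)=\left(\frac r2\right)^{\nu}\sum_{k\ge0}\frac{(r^2/4)^k}{k!\,\Gamma(\nu+k+1)}$ be the modified Bessel function of the first kind. The Hartman–Watson density $f_r$ is the continuous function on $(0,\infty)$ determined by its (absolutely convergent) Laplace transform $$\int_0^\infty e^{-ut}f_r(t)\,dt=\frac{I_{\sqrt{2u}}(r)}{I_0(r)}\qquad(\operatorname{Re}u>0),$$ where $\sqrt{\cdot}$ is the principal branch; such a function exists. For all sufficiently small $t>0$ the equation $$t=\frac{\log u}{2\sqrt{2u}}-\frac{\rho}{\sqrt{2u}}+\frac1{4u}$$ has a largest solution $u=u_0(t)>0$. For fixed $r$, as $t\to0^+$, $$f_r(t)=\frac{\sqrt e}{\pi I_0(r)}\sqrt{\frac{u_0(t)}{\log u_0(t)-2-2\rho}}\;e^{-tu_0(t)+\sqrt{2u_0(t)}}\left(1+O\!\left(\sqrt t\,\log(1/t)^2\right)\right),$$ and also $$f_r(t)=\frac{\sqrt e}{2\pi I_0(r)}\,\frac{\log(1/t)^{1/2}}{t}\;e^{-tu_0(t)+\sqrt{2u_0(t)}}\left(1+O\!\left(\frac{\log\log(1/t)}{\log(1/t)}\right)\right).$$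 -/

import Mathlib

open Real Set Filter Topology Asymptotics MeasureTheory

noncomputable section

/-- The modified Bessel function of the first kind `I_ν(z)` of complex order `ν`, on the principal
branch: `I_ν(z) = (z/2)^ν ∑_{k ≥ 0} (z²/4)^k / (k! Γ(ν + k + 1))`.  (At a pole of `Γ` the quotient
by Mathlib's value `Γ = 0` is `0`, which is the usual convention `1/Γ = 0`.) -/
def besselI (ν z : ℂ) : ℂ :=
  (z / 2) ^ ν *
    ∑' k : ℕ, (z ^ 2 / 4) ^ k / ((k.factorial : ℂ) * Complex.Gamma (ν + (k : ℂ) + 1))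

/-- `I_0(r)` for real `r`, as a real number. -/
def besselI0 (r : ℝ) : ℝ := (besselI 0 (r : ℂ)).re

/-- `f` is (on `(0, ∞)`) the Hartman-Watson density with parameter `r`: the continuous function on
`(0, ∞)` whose Laplace transform is `u ↦ I_{√(2u)}(r) / I_0(r)` for `Re u > 0`, where the square
root is the principal one.  Values of `f` outside `(0, ∞)` play no role. -/
structure IsHartmanWatsonDensity (r : ℝ) (f : ℝ → ℝ) : Prop where
  continuousOn : ContinuousOn f (Ioi 0)
  integrableOn : ∀ u : ℂ, 0 < u.re →
    IntegrableOn (fun t : ℝ => Complex.exp (-u * (t : ℂ)) * (f t : ℂ)) (Ioi 0)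
  laplace : ∀ u : ℂ, 0 < u.re →
    ∫ t in Ioi (0 : ℝ), Complex.exp (-u * (t : ℂ)) * (f t : ℂ) =
      besselI ((2 * u) ^ (1 / 2 : ℂ)) (r : ℂ) / besselI 0 (r : ℂ)

/-- `ρ = log (r / (2√2))`. -/
def rhoParam (r : ℝ) : ℝ := Real.log (r / (2 * √2))

/-- The solutions `u > 0` of `t = log u / (2√(2u)) - ρ / √(2u) + 1 / (4u)`. -/
def saddleSolutions (r t : ℝ) : Set ℝ :=
  {u : ℝ | 0 < u ∧
    t = Real.log u / (2 * √(2 * u)) - rhoParam r / √(2 * u) + 1 / (4 * u)}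

/-- `u_0(t)`: the supremum of the solution set, which is the largest solution when there is one. -/
def saddlePoint (r t : ℝ) : ℝ := sSup (saddleSolutions r t)

end

/-! The density is written as a contour integral in a variable `w`, to which the saddle point method
applies. Schläfli's integral gives `I_ν(r) = (2πi)⁻¹ ∫ exp(r cosh w - ν w) dw` over a Hankel
contour. For `ν = √(2u)` and `w` in the sector `|Im w| < Re w`, the factor `exp(-ν w)` is the
Laplace transform at `u` of the first passage density `w (2π t³)^(-1/2) exp(-w²/(2t))`, continued to
complex `w`. Fubini's theorem then identifies `f_r(t)` as `1 / I_0(r)` times `(2π t³)^(-1/2) (2πi)⁻¹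
∫ w exp(r cosh w - w²/(2t)) dw`. Continuity and Fourier inversion make it the only candidate
(`IsHartmanWatsonDensity.eqOn`).

With `ν = √(2 u₀)` and `a = log(2ν/r)`, the equation for `u₀` becomes `t = a/ν + 1/(2ν²)`. Then `r
sinh a` and `a/t` both equal `ν` up to a bounded error, so `a` is nearly a critical point of the
exponent, and the contour may be moved there by Cauchy's theorem. The term `1/(2ν²)` makes the
exponent at `a` equal to `-t u₀ + √(2 u₀) + 1/2 + o(1)`, whence the factor `√e`. The second
derivative there is about `(a - 1)/t`, so the vertical segment contributes `a √(2πt/(a - 1))` up to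
`O(t)`. On the horizontal rays `cosh w = -cosh(Re w)`, and their contribution is also `O(t)`. This
is `SaddleData.abs_hankelIntegral_sub_le`. Dividing out gives relative error `O(√t)`, which is
stronger than the first formula asks.

The second formula only replaces the prefactor: `log(1/t) = a + log(r/2) - log(tν)` and `tν = a +
O(1)`, so `tν / √((a - 1) log(1/t))` is `1 + O(log log(1/t) / log(1/t))`
(`SaddleData.abs_prefactor_ratio_sub_one_le`). -/

/-! ### Integrals along Hankel contours -/

/-- The Hankel-type contour `∞ - iπ → a - iπ → a + iπ → ∞ + iπ`, parametrised by arc length. -/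
noncomputable def hankelPath (a s : ℝ) : ℂ :=
  ((a + max (|s| - π) 0 : ℝ) : ℂ) + ((max (-π) (min s π) : ℝ) : ℂ) * Complex.I

/-- The derivative of `hankelPath a`, divided by `i`. -/
noncomputable def hankelWeight (s : ℝ) : ℂ :=
  if |s| ≤ π then 1 else if 0 < s then -Complex.I else Complex.I

/-- The normalised contour integral `(2πi)⁻¹ ∫ g(w) dw` along `hankelPath a`. -/
noncomputable def hankelIntegral (a : ℝ) (g : ℂ → ℂ) : ℂ :=
  (1 / (2 * π) : ℂ) * ∫ s : ℝ, hankelWeight s * g (hankelPath a s)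

lemma continuous_hankelPath (a : ℝ) : Continuous (hankelPath a) := by
  unfold hankelPath; fun_prop

lemma measurable_hankelWeight : Measurable hankelWeight := by
  unfold hankelWeight
  refine Measurable.ite ?_ measurable_const (Measurable.ite ?_ measurable_const measurable_const)
  · exact measurableSet_le (by fun_prop) (by fun_prop)
  · exact measurableSet_lt (by fun_prop) (by fun_prop)

lemma norm_hankelWeight (s : ℝ) : ‖hankelWeight s‖ = 1 := by
  unfold hankelWeight; split_ifs <;> simp

lemma hankelPath_re (a s : ℝ) : (hankelPath a s).re = a + max (|s| - π) 0 := by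
  simp [hankelPath]

lemma hankelPath_im (a s : ℝ) : (hankelPath a s).im = max (-π) (min s π) := by
  simp [hankelPath]

lemma le_hankelPath_re (a s : ℝ) : a ≤ (hankelPath a s).re := by
  rw [hankelPath_re]; linarith [le_max_right (|s| - π) 0]

lemma abs_hankelPath_im_le (a s : ℝ) : |(hankelPath a s).im| ≤ π := by
  rw [hankelPath_im, abs_le]
  exact ⟨le_max_left _ _, max_le (by linarith [pi_pos]) (min_le_right _ _)⟩

lemma hankelPath_of_abs_le {a s : ℝ} (h : |s| ≤ π) : hankelPath a s = a + s * Complex.I := by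
  have := abs_le.1 h
  rw [hankelPath, max_eq_right (by linarith), min_eq_left this.2, max_eq_right this.1]
  simp

lemma hankelPath_of_pi_lt {a s : ℝ} (h : π < s) :
    hankelPath a s = ((s + (a - π) : ℝ) : ℂ) + π * Complex.I := by
  have hp := pi_pos
  rw [hankelPath, abs_of_pos (by linarith), max_eq_left (by linarith), min_eq_right h.le,
    max_eq_right (by linarith)]
  push_cast; ring

lemma hankelPath_of_lt_neg_pi {a s : ℝ} (h : s < -π) :
    hankelPath a s = ((-s + (a - π) : ℝ) : ℂ) - π * Complex.I := by
  have hp := pi_pos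
  rw [hankelPath, abs_of_neg (by linarith), max_eq_left (by linarith), min_eq_left (by linarith),
    max_eq_left (by linarith)]
  push_cast; ring

lemma hankelPath_neg (a s : ℝ) :
    hankelPath a (-s) = (starRingEnd ℂ) (hankelPath a s) := by
  apply Complex.ext
  · simp [hankelPath_re]
  · have hp := pi_pos
    simp only [hankelPath_im, Complex.conj_im]
    rcases le_total s π with h | h <;> rcases le_total (-π) s with h' | h'
    · rw [min_eq_left h, max_eq_right h', min_eq_left (by linarith), max_eq_right (by linarith)]
    · rw [min_eq_left h, max_eq_left h', min_eq_right (by linarith), max_eq_right (by linarith)]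
      ring
    · rw [min_eq_right h, max_eq_right (a := -π) (b := π) (by linarith),
        min_eq_left (a := -s) (b := π) (by linarith), max_eq_left (by linarith)]
    · linarith

lemma hankelWeight_neg (s : ℝ) : hankelWeight (-s) = (starRingEnd ℂ) (hankelWeight s) := by
  unfold hankelWeight
  have hp := pi_pos
  by_cases h : |s| ≤ π
  · simp [h]
  · have hs : s ≠ 0 := by rintro rfl; simp at h; linarith
    rcases lt_or_gt_of_ne hs with h1 | h1
    · simp [h, h1, not_lt.2 h1.le]
    · simp [h, h1, not_lt.2 h1.le]

/-- The contour is symmetric under conjugation, so `s ↦ -s` conjugates the integrand. -/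
lemma hankelIntegral_im_eq_zero {a : ℝ} {g : ℂ → ℂ}
    (hg : ∀ w, g ((starRingEnd ℂ) w) = (starRingEnd ℂ) (g w)) :
    (hankelIntegral a g).im = 0 := by
  rw [← Complex.conj_eq_iff_im, hankelIntegral, map_mul, ← integral_conj]
  congr 1
  · simp [map_ofNat]
  · rw [← integral_neg_eq_self (fun s : ℝ => hankelWeight s * g (hankelPath a s))]
    simp only [hankelPath_neg, hankelWeight_neg, hg, map_mul]

lemma mul_sub_mul_exp_le {c K : ℝ} (hc : 0 < c) (hK : 0 < K) (x : ℝ) :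
    K * x - c * rexp x ≤ -K * (log (c / K) + 1) := by
  have h := Real.add_one_le_exp (x + log (c / K))
  rw [Real.exp_add, Real.exp_log (by positivity)] at h
  have : K * (x + log (c / K) + 1) ≤ K * (rexp x * (c / K)) := by gcongr
  have h2 : K * (rexp x * (c / K)) = c * rexp x := by field_simp
  linarith

/-- On the rays `Im w = ±π`, so `exp w = -exp(Re w)` and `c exp w` is negative with exponentially
growing size. It beats any linear term; this is the source of all integrability along the contour.
-/
lemma exists_hankelPath_bound (a : ℝ) {c : ℝ} (hc : 0 < c) (R : ℝ) :
    ∃ C : ℝ, ∀ s, c * (Complex.exp (hankelPath a s)).re + R * ‖hankelPath a s‖ ≤ C - |s| := by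
  have hp := pi_pos
  -- The extra `1` in the slope pays for the `-|s|` on the right-hand side.
  set K := |R| + 1
  have hK : 0 < K := by positivity
  have key := mul_sub_mul_exp_le hc hK
  set D := -K * (log (c / K) + 1)
  refine ⟨c * rexp a + |R| * (|a| + 2 * π) + π + |D| + |R| * |a| + |a| + π, fun s => ?_⟩
  have hn : ‖hankelPath a s‖ ≤ |a| + max (|s| - π) 0 + π := by
    refine (Complex.norm_le_abs_re_add_abs_im _).trans ?_
    have h1 := abs_hankelPath_im_le a s
    have h2 : |(hankelPath a s).re| ≤ |a| + max (|s| - π) 0 := by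
      rw [hankelPath_re]
      exact (abs_add_le _ _).trans (by rw [abs_of_nonneg (le_max_right (|s| - π) 0)])
    linarith
  have hR : R * ‖hankelPath a s‖ ≤ |R| * (|a| + max (|s| - π) 0 + π) :=
    (mul_le_mul_of_nonneg_right (le_abs_self R) (norm_nonneg _)).trans (by gcongr)
  have hRa : 0 ≤ |R| * |a| := by positivity
  have hRp : 0 ≤ |R| * π := by positivity
  rw [Complex.exp_re]
  rcases le_or_gt |s| π with h | h
  · rw [hankelPath_re, max_eq_right (by linarith)]
    rw [max_eq_right (by linarith)] at hR
    have : c * (rexp (a + 0) * Real.cos (hankelPath a s).im) ≤ c * rexp a := by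
      rw [add_zero]
      have := mul_le_mul_of_nonneg_left (Real.cos_le_one (hankelPath a s).im) (Real.exp_pos a).le
      nlinarith
    nlinarith [abs_nonneg a, abs_nonneg D]
  · have him : Real.cos (hankelPath a s).im = -1 := by
      rcases lt_abs.1 h with h | h
      · rw [hankelPath_of_pi_lt h]; simp
      · rw [hankelPath_of_lt_neg_pi (by linarith)]; simp
    rw [him, hankelPath_re, max_eq_left (by linarith)]
    rw [max_eq_left (by linarith)] at hR
    have h3 := key (a + (|s| - π))
    have h4 := le_abs_self D
    have h5 := neg_abs_le a
    have h6 : 0 ≤ c * rexp a := by positivity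
    have h7 : |R| * (-|a|) ≤ |R| * a := by gcongr
    simp only [K] at h3
    nlinarith

lemma integrable_exp_neg_abs : Integrable (fun s : ℝ => rexp (-|s|)) := by
  rw [← integrableOn_univ, ← Set.Iic_union_Ioi (a := (0 : ℝ))]
  refine IntegrableOn.union ?_ ?_
  · refine (integrableOn_exp_Iic 0).congr_fun (fun x hx => ?_) measurableSet_Iic
    simp [abs_of_nonpos (show x ≤ 0 from hx)]
  · refine (exp_neg_integrableOn_Ioi 0 one_pos).congr_fun (fun x hx => ?_) measurableSet_Ioi
    simp [abs_of_pos (show 0 < x from hx)]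

lemma integrable_hankelPath_exp (a : ℝ) {c : ℝ} (hc : 0 < c) (R : ℝ) :
    Integrable (fun s => rexp (c * (Complex.exp (hankelPath a s)).re + R * ‖hankelPath a s‖)) := by
  obtain ⟨C, hC⟩ := exists_hankelPath_bound a hc R
  refine (integrable_exp_neg_abs.const_mul (rexp C)).mono' ?_ (ae_of_all _ fun s => ?_)
  · have := continuous_hankelPath a
    exact Continuous.aestronglyMeasurable (by fun_prop)
  · rw [Real.norm_of_nonneg (Real.exp_pos _).le, ← Real.exp_add]
    exact Real.exp_le_exp.2 (by linarith [hC s])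

lemma integrable_comp_hankelPath {a c R K : ℝ} (hc : 0 < c) {g : ℂ → ℂ} (hg : Continuous g)
    (h : ∀ w : ℂ, a ≤ w.re → |w.im| ≤ π → ‖g w‖ ≤ K * rexp (c * (Complex.exp w).re + R * ‖w‖)) :
    Integrable (fun s => g (hankelPath a s)) :=
  ((integrable_hankelPath_exp a hc R).const_mul K).mono'
    (hg.comp (continuous_hankelPath a)).aestronglyMeasurable
    (ae_of_all _ fun s => h _ (le_hankelPath_re a s) (abs_hankelPath_im_le a s))

lemma Integrable.hankelWeight_mul {φ : ℝ → ℂ} (h : Integrable φ) :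
    Integrable (fun s => hankelWeight s * φ s) :=
  h.bdd_mul measurable_hankelWeight.aestronglyMeasurable
    (ae_of_all _ fun s => (norm_hankelWeight s).le)

section Pieces
variable {a : ℝ} {g : ℂ → ℂ}

lemma measurePreserving_add_Ioi (b d : ℝ) :
    MeasurePreserving (fun s : ℝ => s + d) (volume.restrict (Ioi b))
      (volume.restrict (Ioi (b + d))) := by
  have := (measurePreserving_add_right (volume : Measure ℝ) d).restrict_preimage
    (measurableSet_Ioi (a := b + d))
  simpa using this

lemma setIntegral_Ioi_comp_add (φ : ℝ → ℂ) (b d : ℝ) :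
    ∫ s in Ioi b, φ (s + d) = ∫ x in Ioi (b + d), φ x :=
  (measurePreserving_add_Ioi b d).integral_comp (measurableEmbedding_addRight d) φ

lemma integrableOn_Ioi_comp_add {φ : ℝ → ℂ} {b d : ℝ} :
    IntegrableOn (fun s => φ (s + d)) (Ioi b) ↔ IntegrableOn φ (Ioi (b + d)) :=
  (measurePreserving_add_Ioi b d).integrable_comp_emb (measurableEmbedding_addRight d)

lemma integrableOn_upper (h : Integrable (fun s => g (hankelPath a s))) :
    IntegrableOn (fun x : ℝ => g (x + π * Complex.I)) (Ioi a) := by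
  have h1 := (h.integrableOn (s := Ioi π)).congr_fun
    (g := fun s => (fun x : ℝ => g (x + π * Complex.I)) (s + (a - π)))
    (fun s hs => by simp only [hankelPath_of_pi_lt hs]) measurableSet_Ioi
  simpa using (integrableOn_Ioi_comp_add (φ := fun x : ℝ => g (x + π * Complex.I))).1 h1

lemma integrableOn_lower (h : Integrable (fun s => g (hankelPath a s))) :
    IntegrableOn (fun x : ℝ => g (x - π * Complex.I)) (Ioi a) := by
  have h0 : Integrable (fun s => g (hankelPath a (-s))) := h.comp_neg
  have h1 := (h0.integrableOn (s := Ioi π)).congr_fun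
    (g := fun s => (fun x : ℝ => g (x - π * Complex.I)) (s + (a - π)))
    (fun s hs => by
      have : -s < -π := neg_lt_neg hs
      simp only [hankelPath_of_lt_neg_pi this, neg_neg]) measurableSet_Ioi
  simpa using (integrableOn_Ioi_comp_add (φ := fun x : ℝ => g (x - π * Complex.I))).1 h1

lemma hankelIntegral_eq_pieces (h : Integrable (fun s => g (hankelPath a s))) :
    hankelIntegral a g = (1 / (2 * π) : ℂ) * ((∫ y in (-π)..π, g (a + y * Complex.I)) +
      Complex.I * ∫ x in Ioi a, (g (x - π * Complex.I) - g (x + π * Complex.I))) := by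
  have hp := pi_pos
  have hw := Integrable.hankelWeight_mul h
  rw [hankelIntegral, integral_sub (integrableOn_lower h) (integrableOn_upper h)]
  congr 1
  rw [← intervalIntegral.integral_Iic_add_Ioi (b := -π) hw.integrableOn hw.integrableOn,
    ← intervalIntegral.integral_interval_add_Ioi (a := -π) (b := π) hw.integrableOn
      hw.integrableOn]
  have e1 : ∫ s in Iic (-π), hankelWeight s * g (hankelPath a s) =
      Complex.I * ∫ x in Ioi a, g (x - π * Complex.I) := by
    have := integral_comp_neg_Ioi π (fun s => hankelWeight s * g (hankelPath a s))
    rw [← this, ← integral_const_mul]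
    have h2 := setIntegral_Ioi_comp_add (fun x : ℝ => Complex.I * g (x - π * Complex.I)) π (a - π)
    rw [add_sub_cancel] at h2
    rw [← h2]
    refine setIntegral_congr_fun measurableSet_Ioi fun s hs => ?_
    have hs' : -s < -π := neg_lt_neg hs
    have hs2 : π < s := hs
    simp only [hankelPath_of_lt_neg_pi hs', neg_neg]
    rw [hankelWeight, abs_neg, abs_of_pos (by linarith), if_neg (by linarith),
      if_neg (by linarith)]
  have e2 : ∫ s in Ioi π, hankelWeight s * g (hankelPath a s) =
      -Complex.I * ∫ x in Ioi a, g (x + π * Complex.I) := by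
    rw [← integral_const_mul]
    have h2 := setIntegral_Ioi_comp_add (fun x : ℝ => -Complex.I * g (x + π * Complex.I)) π (a - π)
    rw [add_sub_cancel] at h2
    rw [← h2]
    refine setIntegral_congr_fun measurableSet_Ioi fun s hs => ?_
    have hs2 : π < s := hs
    simp only [hankelPath_of_pi_lt hs]
    rw [hankelWeight, abs_of_pos (by linarith), if_neg (by linarith), if_pos (by linarith)]
  have e3 : ∫ s in (-π)..π, hankelWeight s * g (hankelPath a s) =
      ∫ y in (-π)..π, g (a + y * Complex.I) := by
    refine intervalIntegral.integral_congr fun s hs => ?_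
    rw [uIcc_of_le (by linarith)] at hs
    have : |s| ≤ π := abs_le.2 hs
    simp only [hankelPath_of_abs_le this]
    rw [hankelWeight, if_pos this, one_mul]
  rw [e1, e2, e3]
  ring

/-- Cauchy's theorem: the contour may be shifted. -/
lemma hankelIntegral_shift {b : ℝ} (hg : Differentiable ℂ g)
    (ha : Integrable (fun s => g (hankelPath a s)))
    (hb : Integrable (fun s => g (hankelPath b s))) :
    hankelIntegral a g = hankelIntegral b g := by
  rw [hankelIntegral_eq_pieces ha, hankelIntegral_eq_pieces hb]
  congr 1
  -- The two contours share the outer parts of their rays, so they differ by the boundary of the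
  -- rectangle with real parts between `a` and `b` and imaginary parts between `-π` and `π`.
  have hc := Complex.integral_boundary_rect_eq_zero_of_differentiableOn g
    (a + (-π : ℝ) * Complex.I) (b + π * Complex.I) hg.differentiableOn
  simp only [Complex.add_re, Complex.ofReal_re, Complex.re_ofReal_mul, Complex.I_re, mul_zero,
    add_zero, Complex.add_im, Complex.ofReal_im, Complex.im_ofReal_mul, Complex.I_im, mul_one,
    zero_add, smul_eq_mul] at hc
  have hlow : ∀ x : ℝ, (x : ℂ) + ((-π : ℝ) : ℂ) * Complex.I = x - π * Complex.I := by
    intro x; push_cast; ring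
  simp only [hlow] at hc
  rw [integral_sub (integrableOn_lower ha) (integrableOn_upper ha),
    integral_sub (integrableOn_lower hb) (integrableOn_upper hb),
    ← intervalIntegral.integral_interval_add_Ioi (integrableOn_lower ha) (integrableOn_lower hb),
    ← intervalIntegral.integral_interval_add_Ioi (integrableOn_upper ha) (integrableOn_upper hb)]
  linear_combination Complex.I * hc + (-(∫ y in (-π)..π, g (b + y * Complex.I)) +
    (∫ y in (-π)..π, g (a + y * Complex.I))) * Complex.I_sq

end Pieces

/-! ### Hankel's formula for the reciprocal Gamma function -/

/-- The integrand of Hankel's formula for `1 / Γ`, after the substitution `s = c e ^ w`. -/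
noncomputable def gammaKernel (c : ℝ) (z w : ℂ) : ℂ := Complex.exp (c * Complex.exp w - z * w)

lemma neg_re_mul_le (z w : ℂ) : -(z * w).re ≤ ‖z‖ * ‖w‖ := by
  rw [← norm_mul]
  exact (neg_le_abs _).trans (Complex.abs_re_le_norm _)

lemma norm_gammaKernel_le (c : ℝ) (z w : ℂ) :
    ‖gammaKernel c z w‖ ≤ rexp (c * (Complex.exp w).re + ‖z‖ * ‖w‖) := by
  rw [gammaKernel, Complex.norm_exp]
  have := neg_re_mul_le z w
  apply Real.exp_le_exp.2
  rw [Complex.sub_re, Complex.re_ofReal_mul]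
  linarith

lemma differentiable_gammaKernel (c : ℝ) (z : ℂ) : Differentiable ℂ (gammaKernel c z) := by
  unfold gammaKernel; fun_prop

lemma integrable_gammaKernel (a : ℝ) {c : ℝ} (hc : 0 < c) (z : ℂ) :
    Integrable (fun s => gammaKernel c z (hankelPath a s)) :=
  integrable_comp_hankelPath (K := 1) hc (differentiable_gammaKernel c z).continuous
    fun w _ _ => by rw [one_mul]; exact norm_gammaKernel_le c z w

lemma differentiable_hankelIntegral_gammaKernel (a : ℝ) {c : ℝ} (hc : 0 < c) :
    Differentiable ℂ (fun z => hankelIntegral a (gammaKernel c z)) := by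
  intro z
  unfold hankelIntegral
  refine DifferentiableAt.const_mul ?_ _
  refine (hasDerivAt_integral_of_dominated_loc_of_deriv_le (μ := volume)
    (F := fun (z : ℂ) s => hankelWeight s * gammaKernel c z (hankelPath a s))
    (F' := fun (z : ℂ) s => hankelWeight s *
      (-hankelPath a s * gammaKernel c z (hankelPath a s)))
    (bound := fun s => rexp (c * (Complex.exp (hankelPath a s)).re +
      (‖z‖ + 2) * ‖hankelPath a s‖))
    (Metric.ball_mem_nhds z one_pos) ?_ ?_ ?_ ?_ ?_ ?_).2.differentiableAt
  · exact Eventually.of_forall fun z' =>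
      (Integrable.hankelWeight_mul (integrable_gammaKernel a hc z')).aestronglyMeasurable
  · exact Integrable.hankelWeight_mul (integrable_gammaKernel a hc z)
  · refine measurable_hankelWeight.aestronglyMeasurable.mul ?_
    have h1 := continuous_hankelPath a
    have h2 := (differentiable_gammaKernel c z).continuous
    exact Continuous.aestronglyMeasurable (by fun_prop)
  · refine ae_of_all _ fun s z' hz' => ?_
    rw [norm_mul, norm_mul, norm_hankelWeight, one_mul, norm_neg]
    have hz : ‖z'‖ ≤ ‖z‖ + 1 := by
      have : ‖z' - z‖ < 1 := by simpa [dist_eq_norm] using hz'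
      calc ‖z'‖ = ‖z + (z' - z)‖ := by ring_nf
        _ ≤ _ := (norm_add_le _ _).trans (by linarith)
    calc _ ≤ rexp ‖hankelPath a s‖ * rexp (c * (Complex.exp (hankelPath a s)).re +
          (‖z‖ + 1) * ‖hankelPath a s‖) := by
          gcongr
          · linarith [Real.add_one_le_exp ‖hankelPath a s‖]
          · refine (norm_gammaKernel_le _ _ _).trans (Real.exp_le_exp.2 ?_)
            gcongr
      _ = _ := by rw [← Real.exp_add]; ring_nf
  · exact integrable_hankelPath_exp a hc _
  · refine ae_of_all _ fun s z' _ => ?_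
    have h1 : HasDerivAt (fun z : ℂ => c * Complex.exp (hankelPath a s) - z * hankelPath a s)
        (-hankelPath a s) z' := by
      simpa using ((hasDerivAt_id z').mul_const (hankelPath a s)).const_sub
        ((c : ℂ) * Complex.exp (hankelPath a s))
    have h2 := (h1.cexp).const_mul (hankelWeight s)
    exact h2.congr_deriv (by rw [gammaKernel]; ring)

/-- `exp w` agrees on the two rays, so only the factors `exp(±iπz)` differ, and they combine to a
sine. The factor `rexp x` is split off as the Jacobian of `t = exp x`, which turns the rest into
Euler's integrand. -/
lemma gammaKernel_lower_sub_upper (c : ℝ) (z : ℂ) (x : ℝ) :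
    gammaKernel c z (x - π * Complex.I) - gammaKernel c z (x + π * Complex.I) =
      (2 * Complex.I * Complex.sin (π * z)) *
        (rexp x • (((rexp x : ℝ) : ℂ) ^ (-z - 1) * Complex.exp (-(c * (rexp x : ℝ))))) := by
  have hx : ((rexp x : ℝ) : ℂ) ≠ 0 := by exact_mod_cast (Real.exp_pos x).ne'
  have h1 : ((rexp x : ℝ) : ℂ) ^ (-z - 1) = Complex.exp (x * (-z - 1)) := by
    rw [Complex.cpow_def_of_ne_zero hx, ← Complex.ofReal_log (Real.exp_pos x).le, Real.log_exp]
  have h2 : Complex.exp (x - π * Complex.I) = -(rexp x : ℝ) := by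
    rw [Complex.exp_sub, Complex.exp_pi_mul_I, Complex.ofReal_exp]; ring
  have h3 : Complex.exp (x + π * Complex.I) = -(rexp x : ℝ) := by
    rw [Complex.exp_add, Complex.exp_pi_mul_I, Complex.ofReal_exp]; ring
  have h4 : 2 * Complex.I * Complex.sin (π * z) =
      Complex.exp (z * π * Complex.I) - Complex.exp (-(z * π * Complex.I)) := by
    rw [Complex.sin]
    have e1 : -(π * z) * Complex.I = -(z * π * Complex.I) := by ring
    have e2 : (π * z) * Complex.I = z * π * Complex.I := by ring
    rw [e1, e2]
    linear_combination (Complex.exp (-(z * π * Complex.I)) - Complex.exp (z * π * Complex.I)) *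
      Complex.I_sq
  rw [gammaKernel, gammaKernel, h2, h3, h4, h1, Complex.real_smul, Complex.ofReal_exp]
  have e : ∀ y : ℂ, Complex.exp (c * -Complex.exp x - z * (x - y)) =
      Complex.exp (z * y) *
        (Complex.exp x * (Complex.exp (x * (-z - 1)) * Complex.exp (-(c * Complex.exp x)))) := by
    intro y
    rw [← Complex.exp_add, ← Complex.exp_add, ← Complex.exp_add]
    ring_nf
  have e1 := e (π * Complex.I)
  have e2 := e (-(π * Complex.I))
  rw [sub_neg_eq_add] at e2
  rw [e1, e2]
  ring_nf

lemma hankelIntegral_gammaKernel_eq (a : ℝ) {c : ℝ} (hc : 0 < c) (z : ℂ) :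
    hankelIntegral a (gammaKernel c z) = (1 / (2 * π) : ℂ) *
      ((∫ y in (-π)..π, gammaKernel c z (a + y * Complex.I)) -
        2 * Complex.sin (π * z) *
          ∫ t in Ioi (rexp a), ((t : ℂ) ^ (-z - 1) * Complex.exp (-(c * t)))) := by
  rw [hankelIntegral_eq_pieces (integrable_gammaKernel a hc z)]
  simp only [gammaKernel_lower_sub_upper]
  rw [integral_const_mul,
    integral_comp_exp_Ioi (fun t : ℝ => (t : ℂ) ^ (-z - 1) * Complex.exp (-(c * t)))]
  linear_combination (1 / (2 * π) : ℂ) * (2 * Complex.sin (π * z) *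
    ∫ t in Ioi (rexp a), ((t : ℂ) ^ (-z - 1) * Complex.exp (-(c * t)))) * Complex.I_sq

/-- For `Re z < 0` the factor `exp(-z w)` decays as `Re w → -∞`, while `c exp w` tends to zero. -/
lemma tendsto_gammaKernel_vertical {c : ℝ} (hc : 0 < c) {z : ℂ} (hz : z.re < 0) :
    Tendsto (fun a : ℝ => ∫ y in (-π)..π, gammaKernel c z (a + y * Complex.I)) atBot (𝓝 0) := by
  have hb : Tendsto (fun a : ℝ => rexp (c * rexp a + (-z.re) * a + |z.im| * π) * |π - -π|)
      atBot (𝓝 0) := by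
    rw [show (0 : ℝ) = 0 * |π - -π| by ring]
    refine Tendsto.mul_const _ (tendsto_exp_atBot.comp ?_)
    refine Tendsto.atBot_add (C := |z.im| * π) ?_ tendsto_const_nhds
    exact Tendsto.add_atBot (tendsto_exp_atBot.const_mul c)
      (tendsto_id.const_mul_atBot (by linarith))
  refine squeeze_zero_norm (fun a => ?_) hb
  refine intervalIntegral.norm_integral_le_of_norm_le_const fun y hy => ?_
  have hp := pi_pos
  rw [uIoc_of_le (by linarith)] at hy
  have hy' : |y| ≤ π := abs_le.2 ⟨hy.1.le, hy.2⟩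
  rw [gammaKernel, Complex.norm_exp]
  apply Real.exp_le_exp.2
  have h1 : (Complex.exp (a + y * Complex.I)).re ≤ rexp a := by
    refine (Complex.re_le_norm _).trans ?_
    rw [Complex.norm_exp]; simp
  have h2 : (z * (a + y * Complex.I)).re = z.re * a - z.im * y := by simp
  rw [Complex.sub_re, Complex.re_ofReal_mul, h2]
  have h3 : z.im * y ≤ |z.im| * π := (le_abs_self _).trans (by rw [abs_mul]; gcongr)
  have h4 : c * (Complex.exp (a + y * Complex.I)).re ≤ c * rexp a := by gcongr
  linarith

/-- The integral does not depend on `a`. Letting `a → -∞` removes the vertical segment and leaves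
`sin(πz)` times Euler's integral for `Γ(-z)`; the reflection formula finishes. -/
lemma hankelIntegral_gammaKernel_of_re_neg (a : ℝ) {c : ℝ} (hc : 0 < c) {z : ℂ} (hz : z.re < 0) :
    hankelIntegral a (gammaKernel c z) = (c : ℂ) ^ z * (Complex.Gamma (z + 1))⁻¹ := by
  have hz' : 0 < (-z).re := by simpa using hz
  have hΓ : Complex.Gamma (-z) ≠ 0 := Complex.Gamma_ne_zero_of_re_pos hz'
  have hc0 : (c : ℂ) ≠ 0 := by exact_mod_cast hc.ne'
  have hval := Complex.integral_cpow_mul_exp_neg_mul_Ioi hz' hc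
  have hcp : (1 / c : ℂ) ^ (-z) = (c : ℂ) ^ z := by
    rw [one_div, Complex.cpow_neg, Complex.inv_cpow _ _ (by
      rw [Complex.arg_ofReal_of_nonneg hc.le]; exact pi_pos.ne), inv_inv]
  have hint : IntegrableOn (fun t : ℝ => (t : ℂ) ^ (-z - 1) * Complex.exp (-(c * t))) (Ioi 0) := by
    -- A non-integrable function has Bochner integral `0`, whereas the known value of this integral
    -- is nonzero.
    by_contra hcon
    rw [integral_undef hcon, hcp] at hval
    exact mul_ne_zero (by simp [Complex.cpow_eq_zero_iff, hc0]) hΓ hval.symm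
  have hlim : Tendsto (fun b : ℝ =>
      ∫ t in Ioi (rexp b), ((t : ℂ) ^ (-z - 1) * Complex.exp (-(c * t)))) atBot
      (𝓝 (∫ t in Ioi (0 : ℝ), ((t : ℂ) ^ (-z - 1) * Complex.exp (-(c * t))))) := by
    have hcov := aecover_Ioi_of_Ioi (μ := volume) tendsto_exp_atBot
    refine (hcov.integral_tendsto_of_countably_generated hint).congr fun b => ?_
    rw [Measure.restrict_restrict measurableSet_Ioi,
      inter_eq_left.2 (Ioi_subset_Ioi (Real.exp_pos b).le)]
  have hall := (((tendsto_gammaKernel_vertical hc hz).sub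
    (hlim.const_mul (2 * Complex.sin (π * z)))).const_mul (1 / (2 * π) : ℂ))
  have heq : hankelIntegral a (gammaKernel c z) = _ := tendsto_nhds_unique
    (tendsto_const_nhds.congr fun b => by
      rw [← hankelIntegral_gammaKernel_eq b hc z]
      exact hankelIntegral_shift (differentiable_gammaKernel c z) (integrable_gammaKernel a hc z)
        (integrable_gammaKernel b hc z)) hall
  rw [heq, hval, hcp]
  have hrefl := Complex.Gamma_mul_Gamma_one_sub (-z)
  rw [sub_neg_eq_add, add_comm 1 z, mul_neg, Complex.sin_neg] at hrefl
  have hpi : (π : ℂ) ≠ 0 := by exact_mod_cast pi_ne_zero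
  -- When the sine vanishes, `z + 1` is a pole of `Γ`, where the assigned value `0` makes both sides
  -- zero; the reflection formula delivers this through division by zero.
  by_cases hs : Complex.sin (π * z) = 0
  · rw [hs, neg_zero, div_zero] at hrefl
    have h0 := (mul_eq_zero.1 hrefl).resolve_left hΓ
    rw [hs, h0]; simp
  · have h0 : Complex.Gamma (z + 1) ≠ 0 := by
      intro h; rw [h, mul_zero] at hrefl
      exact (div_ne_zero hpi (neg_ne_zero.2 hs)) hrefl.symm
    rw [eq_div_iff (neg_ne_zero.2 hs)] at hrefl
    field_simp
    linear_combination 2 * (c : ℂ) ^ z * hrefl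

/-- **Hankel's formula** for the reciprocal of the Gamma function. -/
lemma hankelIntegral_gammaKernel (a : ℝ) {c : ℝ} (hc : 0 < c) (z : ℂ) :
    hankelIntegral a (gammaKernel c z) = (c : ℂ) ^ z * (Complex.Gamma (z + 1))⁻¹ := by
  have hc0 : (c : ℂ) ≠ 0 := by exact_mod_cast hc.ne'
  have h1 : AnalyticOnNhd ℂ (fun z => hankelIntegral a (gammaKernel c z)) univ :=
    (differentiable_hankelIntegral_gammaKernel a hc).differentiableOn.analyticOnNhd isOpen_univ
  have hd : Differentiable ℂ (fun z : ℂ => (c : ℂ) ^ z * (Complex.Gamma (z + 1))⁻¹) :=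
    (differentiable_id.const_cpow (Or.inl hc0)).mul
      (Complex.differentiable_one_div_Gamma.comp (differentiable_id.add_const 1))
  have h2 := hd.differentiableOn.analyticOnNhd isOpen_univ
  have hev : ∀ᶠ z : ℂ in 𝓝 (-1), z.re < 0 :=
    (isOpen_lt Complex.continuous_re continuous_const).mem_nhds (by simp)
  -- Both sides are entire in `z` and agree near `-1`, so the identity theorem applies.
  exact congrFun (h1.eq_of_eventuallyEq h2
    (hev.mono fun w hw => hankelIntegral_gammaKernel_of_re_neg a hc hw)) z

/-! ### Schläfli's integral for the modified Bessel function -/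

/-- The integrand of the Schläfli contour integral for `I_ν(r)`. -/
noncomputable def besselKernel (r : ℝ) (ν w : ℂ) : ℂ := Complex.exp (r * Complex.cosh w - ν * w)

lemma besselKernel_eq (r : ℝ) (ν w : ℂ) :
    besselKernel r ν w = Complex.exp ((r / 2 : ℝ) * Complex.exp (-w)) *
      gammaKernel (r / 2) ν w := by
  rw [besselKernel, gammaKernel, ← Complex.exp_add, Complex.cosh]
  congr 1; push_cast; ring

lemma re_exp_neg_le {a : ℝ} {w : ℂ} (h : a ≤ w.re) : ‖Complex.exp (-w)‖ ≤ rexp (-a) := by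
  rw [Complex.norm_exp]; apply Real.exp_le_exp.2; simpa using h

lemma norm_exp_mul_cosh_le {r a : ℝ} (hr : 0 < r) {w : ℂ} (h : a ≤ w.re) :
    ‖Complex.exp (r * Complex.cosh w)‖ ≤
      rexp (r / 2 * rexp (-a)) * rexp (r / 2 * (Complex.exp w).re) := by
  rw [Complex.norm_exp, ← Real.exp_add, Complex.cosh]
  apply Real.exp_le_exp.2
  have h1 : (Complex.exp (-w)).re ≤ rexp (-a) := (Complex.re_le_norm _).trans (re_exp_neg_le h)
  rw [Complex.re_ofReal_mul, show ((Complex.exp w + Complex.exp (-w)) / 2).re =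
    ((Complex.exp w).re + (Complex.exp (-w)).re) / 2 by simp]
  nlinarith

/-- Expand `exp((r/2) exp(-w))` in its power series. Since `|exp(-w)| ≤ exp(-a)` on the contour, an
exponential series dominates and the sum may be integrated term by term; each factor `exp(-k w)`
shifts the order to `ν + k`. -/
lemma hasSum_hankelIntegral_besselKernel {r : ℝ} (hr : 0 < r) (a : ℝ) (ν : ℂ) :
    HasSum (fun k : ℕ => ((r / 2 : ℝ) : ℂ) ^ k / (k.factorial : ℂ) *
      hankelIntegral a (gammaKernel (r / 2) (ν + k))) (hankelIntegral a (besselKernel r ν)) := by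
  have hr2 : 0 < r / 2 := by positivity
  set F : ℕ → ℝ → ℂ := fun k s => hankelWeight s * (((r / 2 : ℝ) : ℂ) ^ k / (k.factorial : ℂ) *
    gammaKernel (r / 2) (ν + k) (hankelPath a s)) with hF
  have hterm : ∀ k w, gammaKernel (r / 2) (ν + (k : ℕ)) w =
      Complex.exp (-w) ^ k * gammaKernel (r / 2) ν w := by
    intro k w
    rw [gammaKernel, gammaKernel, ← Complex.exp_nat_mul, ← Complex.exp_add]
    congr 1; ring
  have hint : ∀ k, Integrable (F k) := fun k =>
    Integrable.hankelWeight_mul ((integrable_gammaKernel a hr2 _).const_mul _)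
  have hbase := integrable_gammaKernel a hr2 ν
  have hnorm : ∀ k, ∫ s, ‖F k s‖ ≤
      (r / 2 * rexp (-a)) ^ k / (k.factorial : ℝ) *
        ∫ s, ‖gammaKernel (r / 2) ν (hankelPath a s)‖ := by
    intro k
    rw [← integral_const_mul]
    refine integral_mono (hint k).norm (hbase.norm.const_mul _) fun s => ?_
    simp only [hF]
    rw [norm_mul, norm_hankelWeight, one_mul, hterm, norm_mul, norm_mul, norm_div, norm_pow,
      norm_pow, Complex.norm_natCast, Complex.norm_of_nonneg hr2.le, ← mul_assoc]
    gcongr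
    rw [mul_pow, div_mul_eq_mul_div]
    gcongr
    exact re_exp_neg_le (le_hankelPath_re a s)
  have hsum : Summable fun k => ∫ s, ‖F k s‖ :=
    Summable.of_nonneg_of_le (fun k => integral_nonneg fun s => norm_nonneg _) hnorm
      ((Real.summable_pow_div_factorial _).mul_right _)
  have hmain := (hasSum_integral_of_summable_integral_norm hint hsum).mul_left (1 / (2 * π) : ℂ)
  have e1 : (fun k : ℕ => ((r / 2 : ℝ) : ℂ) ^ k / (k.factorial : ℂ) *
      hankelIntegral a (gammaKernel (r / 2) (ν + k))) =
      fun k => (1 / (2 * π) : ℂ) * ∫ s, F k s := by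
    funext k
    simp only [hF, hankelIntegral]
    rw [← mul_assoc, mul_comm (((r / 2 : ℝ) : ℂ) ^ k / (k.factorial : ℂ)), mul_assoc,
      ← integral_const_mul]
    congr 2
    funext s; ring
  have e2 : hankelIntegral a (besselKernel r ν) = (1 / (2 * π) : ℂ) * ∫ s, ∑' k, F k s := by
    rw [hankelIntegral]
    congr 2
    funext s
    simp only [hF, hterm, besselKernel_eq]
    rw [tsum_mul_left]
    congr 1
    rw [Complex.exp_eq_exp_ℂ, NormedSpace.exp_eq_tsum_div, ← tsum_mul_right]
    congr 1
    funext k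
    rw [mul_pow]; ring
  rw [e1, e2]
  exact hmain

/-- **Schläfli's integral** for the modified Bessel function. -/
lemma hankelIntegral_besselKernel {r : ℝ} (hr : 0 < r) (a : ℝ) (ν : ℂ) :
    hankelIntegral a (besselKernel r ν) = besselI ν r := by
  have hr2 : 0 < r / 2 := by positivity
  have hr0 : (r : ℂ) / 2 ≠ 0 := by exact_mod_cast hr2.ne'
  rw [besselI, ← (hasSum_hankelIntegral_besselKernel hr a ν).tsum_eq, ← tsum_mul_left]
  congr 1
  funext k
  rw [hankelIntegral_gammaKernel a hr2]
  push_cast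
  rw [Complex.cpow_add _ _ hr0, Complex.cpow_natCast, div_eq_mul_inv _ ((k.factorial : ℂ) * _),
    mul_inv, div_eq_mul_inv _ (k.factorial : ℂ)]
  have : ((r : ℂ) ^ 2 / 4) ^ k = (r / 2 : ℂ) ^ k * (r / 2 : ℂ) ^ k := by
    rw [← mul_pow]; ring
  rw [this]; ring

lemma besselI_zero_eq (r : ℝ) :
    besselI 0 r = ((∑' k : ℕ, (r ^ 2 / 4) ^ k / ((k.factorial : ℝ) * k.factorial) : ℝ) : ℂ) := by
  rw [besselI, Complex.cpow_zero, one_mul, Complex.ofReal_tsum]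
  congr 1
  funext k
  rw [zero_add, Complex.Gamma_nat_eq_factorial]
  push_cast; rfl

lemma ofReal_besselI0 (r : ℝ) : (besselI0 r : ℂ) = besselI 0 r := by
  rw [besselI0, besselI_zero_eq, Complex.ofReal_re]

lemma besselI0_pos (r : ℝ) : 0 < besselI0 r := by
  rw [besselI0, besselI_zero_eq, Complex.ofReal_re]
  have hs : Summable fun k : ℕ => (r ^ 2 / 4) ^ k / ((k.factorial : ℝ) * k.factorial) := by
    refine Summable.of_nonneg_of_le (fun k => by positivity) (fun k => ?_)
      (Real.summable_pow_div_factorial (r ^ 2 / 4))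
    have h1 : (1 : ℝ) ≤ k.factorial := by exact_mod_cast k.factorial_pos
    gcongr
    nlinarith
  exact hs.tsum_pos (fun k => by positivity) 0 (by simp)

/-! ### Laplace transform of the first passage density at complex level -/

/-- The primitive used below contains `1/√t`, so its value at the endpoint is meaningless; it is
overwritten by the one-sided limit. -/
lemma integral_Ioi_of_hasDerivAt_of_tendsto_nhdsGT {f f' : ℝ → ℂ} {a : ℝ} {m n : ℂ}
    (hderiv : ∀ x ∈ Ioi a, HasDerivAt f (f' x) x) (hint : IntegrableOn f' (Ioi a))
    (ha : Tendsto f (𝓝[>] a) (𝓝 m)) (htop : Tendsto f atTop (𝓝 n)) :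
    ∫ x in Ioi a, f' x = n - m := by
  have heq : ∀ x ∈ Ioi a, f =ᶠ[𝓝 x] Function.update f a m := fun x hx => by
    filter_upwards [isOpen_Ioi.mem_nhds hx] with y hy
    rw [Function.update_of_ne (ne_of_gt hy)]
  have := integral_Ioi_of_hasDerivAt_of_tendsto (f := Function.update f a m) (f' := f')
    (a := a) (m := n) ?_ (fun x hx => (hderiv x hx).congr_of_eventuallyEq (heq x hx).symm) hint ?_
  · simpa using this
  · rw [continuousWithinAt_update_same, Ici_sdiff_left]
    exact ha
  · refine htop.congr' ?_
    filter_upwards [Ioi_mem_atTop a] with x hx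
    rw [Function.update_of_ne (ne_of_gt hx)]

lemma inv_mul_sqrt_mul_exp_le {c t : ℝ} (hc : 0 < c) (ht : 0 < t) :
    (t * √t)⁻¹ * rexp (-(c / t)) ≤ 1 / c + 2 / c ^ 2 := by
  set x := t⁻¹ with hx
  have hx0 : 0 < x := inv_pos.2 ht
  have h1 : (t * √t)⁻¹ = x * √x := by rw [mul_inv, hx, Real.sqrt_inv]
  have h2 : √x ≤ 1 + x := by
    have := Real.sq_sqrt hx0.le
    nlinarith [sq_nonneg (√x - 1), Real.sqrt_nonneg x]
  have h3 : c / t = c * x := by rw [hx]; rfl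
  have h4 := Real.quadratic_le_exp_of_nonneg (x := c * x) (by positivity)
  rw [h1, h3, Real.exp_neg, ← div_eq_mul_inv, div_le_iff₀ (Real.exp_pos _)]
  have h5 : x * √x ≤ x + x ^ 2 := by nlinarith
  have h6 : x ≤ 1 / c * rexp (c * x) := by
    rw [div_mul_eq_mul_div, one_mul, le_div_iff₀ hc]; nlinarith [sq_nonneg (c * x)]
  have h7 : x ^ 2 ≤ 2 / c ^ 2 * rexp (c * x) := by
    rw [div_mul_eq_mul_div, le_div_iff₀ (by positivity)]
    nlinarith [mul_pos hc hx0]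
  linarith

section GaussianPrimitive
variable {G : ℂ → ℂ} (hG : ∀ z, HasDerivAt G (Complex.exp (-z ^ 2 / 2)) z)
include hG

/-- On the vertical segment from `Re z` to `z` one has `|exp(-w²/2)| ≤ exp(-(1 - κ²)(Re z)²/2)`, and
the segment has length at most `κ |Re z|`. Hence in such a sector `G` has the same limits at
infinity as on the real axis. -/
lemma norm_gaussian_primitive_sub_le {κ : ℝ} (hκ0 : 0 ≤ κ) (hκ : κ < 1) {z : ℂ}
    (hz : |z.im| ≤ κ * |z.re|) (hz0 : z.re ≠ 0) :
    ‖G z - G z.re‖ ≤ κ * (2 / (1 - κ ^ 2)) * |z.re|⁻¹ := by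
  set x := z.re with hx
  set M := κ * |x| with hM
  have hM0 : 0 ≤ M := by positivity
  have hx0 : 0 < |x| := abs_pos.2 hz0
  have hκ2 : 0 < 1 - κ ^ 2 := by nlinarith
  set c := (1 - κ ^ 2) / 2 with hc
  have hc0 : 0 < c := by positivity
  have hconv : Convex ℝ (({x} : Set ℝ) ×ℂ Icc (-M) M) :=
    ((convex_singleton x).linear_preimage Complex.reLm).inter
      ((convex_Icc _ _).linear_preimage Complex.imLm)
  have hmain := hconv.norm_image_sub_le_of_norm_hasDerivWithin_le (f := G)
    (f' := fun z => Complex.exp (-z ^ 2 / 2)) (C := rexp (-(c * x ^ 2)))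
    (x := (x : ℂ)) (y := z) (fun w _ => (hG w).hasDerivWithinAt) ?_ ?_ ?_
  · refine hmain.trans ?_
    have h1 : ‖z - x‖ ≤ κ * |x| := by
      have : z - x = z.im * Complex.I := by
        conv_lhs => rw [← Complex.re_add_im z]
        rw [hx]; ring
      rw [this]; simpa using hz
    have h2 : rexp (-(c * x ^ 2)) ≤ (c * x ^ 2)⁻¹ := by
      rw [Real.exp_neg]
      have hcx : 0 < c * x ^ 2 := by positivity
      exact inv_anti₀ hcx (by linarith [Real.add_one_le_exp (c * x ^ 2)])
    calc _ ≤ (c * x ^ 2)⁻¹ * (κ * |x|) := by gcongr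
      _ = _ := by
        rw [← sq_abs x, hc]; field_simp
  · rintro w ⟨hw1, hw2⟩
    have hw1' : w.re = x := hw1
    rw [Complex.norm_exp]
    apply Real.exp_le_exp.2
    have h3 : (-w ^ 2 / 2).re = -(w.re ^ 2 - w.im ^ 2) / 2 := by
      rw [show -w ^ 2 / 2 = ((1 / 2 : ℝ) : ℂ) * (-w ^ 2) by push_cast; ring,
        Complex.re_ofReal_mul, Complex.neg_re, sq, Complex.mul_re]
      ring
    have h4 : w.im ^ 2 ≤ κ ^ 2 * x ^ 2 := by
      have : |w.im| ≤ M := abs_le.2 hw2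
      rw [← sq_abs w.im, ← sq_abs x, ← mul_pow]
      gcongr
    rw [h3, hw1', hc]
    linarith
  · exact ⟨by simp, by simpa using hM0⟩
  · exact ⟨by simp [hx], abs_le.1 hz⟩

lemma gaussian_primitive_ofReal (x : ℝ) :
    G x - G 0 = ((∫ s in (0 : ℝ)..x, rexp (-(1 / 2) * s ^ 2) : ℝ) : ℂ) := by
  have h := intervalIntegral.integral_eq_sub_of_hasDerivAt (a := 0) (b := x)
    (f := fun s : ℝ => G s) (f' := fun s : ℝ => ((rexp (-(1 / 2) * s ^ 2) : ℝ) : ℂ))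
    (fun s _ => by
      refine (hG s).comp_ofReal.congr_deriv ?_
      rw [Complex.ofReal_exp]
      congr 1
      push_cast; ring)
    (Continuous.intervalIntegrable (by fun_prop) _ _)
  rw [intervalIntegral.integral_ofReal] at h
  rw [h]; simp

lemma tendsto_gaussian_primitive_atTop :
    Tendsto (fun x : ℝ => G x) atTop (𝓝 (G 0 + ((√(2 * π) / 2 : ℝ) : ℂ))) := by
  have h1 := intervalIntegral_tendsto_integral_Ioi (0 : ℝ)
    ((integrable_exp_neg_mul_sq (b := 1 / 2) (by norm_num)).integrableOn) tendsto_id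
  rw [integral_gaussian_Ioi, show π / (1 / 2) = 2 * π by ring] at h1
  have h2 := (Complex.continuous_ofReal.tendsto _).comp h1
  refine (h2.const_add (G 0)).congr fun x => ?_
  have := gaussian_primitive_ofReal hG x
  simp only [Function.comp, id]
  rw [← this]; ring

lemma tendsto_gaussian_primitive_atBot :
    Tendsto (fun x : ℝ => G x) atBot (𝓝 (G 0 - ((√(2 * π) / 2 : ℝ) : ℂ))) := by
  have h1 := intervalIntegral_tendsto_integral_Ioi (0 : ℝ)
    ((integrable_exp_neg_mul_sq (b := 1 / 2) (by norm_num)).integrableOn)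
    (tendsto_neg_atBot_atTop (G := ℝ))
  rw [integral_gaussian_Ioi, show π / (1 / 2) = 2 * π by ring] at h1
  have h2 := (Complex.continuous_ofReal.tendsto _).comp h1
  refine (h2.const_sub (G 0)).congr fun x => ?_
  have h3 := gaussian_primitive_ofReal hG x
  have h4 : ∫ s in (0 : ℝ)..x, rexp (-(1 / 2) * s ^ 2) =
      -∫ s in (0 : ℝ)..(-x), rexp (-(1 / 2) * s ^ 2) := by
    have := intervalIntegral.integral_comp_neg (a := 0) (b := x)
      (fun s => rexp (-(1 / 2) * s ^ 2))
    simp only [neg_sq, neg_zero] at this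
    rw [this, intervalIntegral.integral_symm]
  rw [h4] at h3
  simp only [Function.comp]
  push_cast at h3 ⊢
  linear_combination -h3

lemma tendsto_gaussian_primitive_of_sector {ι : Type*} {l : Filter ι} {z : ι → ℂ} {κ : ℝ}
    {L : ℂ} {l' : Filter ℝ} (hκ0 : 0 ≤ κ) (hκ : κ < 1)
    (hz : ∀ᶠ i in l, |(z i).im| ≤ κ * |(z i).re|)
    (hre : Tendsto (fun i => (z i).re) l l') (habs : Tendsto (fun i => |(z i).re|) l atTop)
    (hL : Tendsto (fun x : ℝ => G x) l' (𝓝 L)) :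
    Tendsto (fun i => G (z i)) l (𝓝 L) := by
  have h1 : Tendsto (fun i => G (z i) - G (z i).re) l (𝓝 0) := by
    have h2 : Tendsto (fun i => κ * (2 / (1 - κ ^ 2)) * |(z i).re|⁻¹) l (𝓝 0) := by
      simpa using habs.inv_tendsto_atTop.const_mul (κ * (2 / (1 - κ ^ 2)))
    refine squeeze_zero_norm' ?_ h2
    filter_upwards [hz, habs.eventually_gt_atTop 0] with i hi hi'
    exact norm_gaussian_primitive_sub_le hG hκ0 hκ hi (abs_pos.1 hi')
  simpa using h1.add (hL.comp hre)

end GaussianPrimitive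

lemma re_sq_div_two_pos_of_abs_im_lt {w : ℂ} (hw : |w.im| < w.re) : 0 < (w ^ 2).re := by
  rw [sq, Complex.mul_re]
  have := abs_lt.1 hw
  nlinarith

lemma exists_sector_bound {w : ℂ} (hw : |w.im| < w.re) :
    ∃ κ, 0 ≤ κ ∧ κ < 1 ∧ |w.im| ≤ κ * w.re := by
  have h0 : 0 < w.re := (abs_nonneg _).trans_lt hw
  exact ⟨|w.im| / w.re, by positivity, (div_lt_one h0).2 hw, by rw [div_mul_cancel₀ _ h0.ne']⟩

lemma norm_subordinator_integrand (u w : ℂ) {t : ℝ} (ht : 0 < t) :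
    ‖Complex.exp (-u * t) * (w * (((√(2 * π) * (t * √t))⁻¹ : ℝ) : ℂ) *
      Complex.exp (-w ^ 2 / (2 * t)))‖ =
    ‖w‖ * (√(2 * π))⁻¹ * ((t * √t)⁻¹ * rexp (-((w ^ 2).re / 2 / t))) * rexp (-(u.re * t)) := by
  rw [norm_mul, norm_mul, norm_mul, Complex.norm_exp, Complex.norm_exp, Complex.norm_real,
    Real.norm_of_nonneg (by positivity), mul_inv]
  have h1 : (-u * t).re = -(u.re * t) := by simp
  have h2 : (-w ^ 2 / (2 * t)).re = -((w ^ 2).re / 2 / t) := by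
    rw [show -w ^ 2 / (2 * t) = (((2 * t)⁻¹ : ℝ) : ℂ) * -(w ^ 2) by push_cast; field_simp,
      Complex.re_ofReal_mul, Complex.neg_re]
    field_simp
  rw [h1, h2]; ring

lemma norm_subordinator_integrand_le {u w : ℂ} {c t : ℝ} (hc : 0 < c)
    (hw : c ≤ (w ^ 2).re) (ht : 0 < t) :
    ‖Complex.exp (-u * t) * (w * (((√(2 * π) * (t * √t))⁻¹ : ℝ) : ℂ) *
      Complex.exp (-w ^ 2 / (2 * t)))‖ ≤
    ‖w‖ * ((√(2 * π))⁻¹ * (1 / (c / 2) + 2 / (c / 2) ^ 2) * rexp (-(u.re * t))) := by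
  rw [norm_subordinator_integrand u w ht]
  have h := inv_mul_sqrt_mul_exp_le (c := c / 2) (by positivity) ht
  have h2 : (t * √t)⁻¹ * rexp (-((w ^ 2).re / 2 / t)) ≤ (t * √t)⁻¹ * rexp (-(c / 2 / t)) := by
    gcongr
  have h3 := h2.trans h
  calc _ ≤ ‖w‖ * (√(2 * π))⁻¹ * (1 / (c / 2) + 2 / (c / 2) ^ 2) * rexp (-(u.re * t)) := by
        gcongr
    _ = _ := by ring

lemma integrableOn_exp_neg_mul {ε : ℝ} (hε : 0 < ε) (C : ℝ) :
    IntegrableOn (fun t : ℝ => C * rexp (-(ε * t))) (Ioi 0) := by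
  have := (exp_neg_integrableOn_Ioi 0 hε).const_mul C
  unfold IntegrableOn
  simpa only [neg_mul] using this

lemma measurable_subordinator_integrand (u w : ℂ) :
    Measurable fun t : ℝ => Complex.exp (-u * t) * (w * (((√(2 * π) * (t * √t))⁻¹ : ℝ) : ℂ) *
      Complex.exp (-w ^ 2 / (2 * t))) := by
  fun_prop

lemma integrableOn_subordinator {u w : ℂ} (hu : 0 < u.re) (hw : 0 < (w ^ 2).re) :
    IntegrableOn (fun t : ℝ => Complex.exp (-u * t) * (w * (((√(2 * π) * (t * √t))⁻¹ : ℝ) : ℂ) *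
      Complex.exp (-w ^ 2 / (2 * t)))) (Ioi 0) := by
  refine Integrable.mono' (integrableOn_exp_neg_mul hu (‖w‖ * ((√(2 * π))⁻¹ *
    (1 / ((w ^ 2).re / 2) + 2 / ((w ^ 2).re / 2) ^ 2))))
    (measurable_subordinator_integrand u w).aestronglyMeasurable ?_
  filter_upwards [ae_restrict_mem measurableSet_Ioi] with t ht
  refine (norm_subordinator_integrand_le hw le_rfl ht).trans (le_of_eq ?_)
  ring

/-- The Laplace transform of the density of the first passage time of Brownian motion, for complex
level and complex argument. -/
lemma integral_subordinator {u v w : ℂ} (hu : 0 < u.re) (huv : v ^ 2 = 2 * u)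
    (hv : |v.im| < v.re) (hw : |w.im| < w.re) :
    ∫ t in Ioi (0 : ℝ), Complex.exp (-u * t) * (w * (((√(2 * π) * (t * √t))⁻¹ : ℝ) : ℂ) *
      Complex.exp (-w ^ 2 / (2 * t))) = Complex.exp (-(v * w)) := by
  obtain ⟨G, hG'⟩ := (show Differentiable ℂ fun z : ℂ => Complex.exp (-z ^ 2 / 2) by
    fun_prop).isExactOn_univ
  have hG : ∀ z, HasDerivAt G (Complex.exp (-z ^ 2 / 2)) z := fun z => hG' z (mem_univ z)
  have hv0 : 0 < v.re := (abs_nonneg _).trans_lt hv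
  have hw0 : 0 < w.re := (abs_nonneg _).trans_lt hw
  obtain ⟨κ₁, h10, h11, h12⟩ := exists_sector_bound hv
  obtain ⟨κ₂, h20, h21, h22⟩ := exists_sector_bound hw
  set κ := max κ₁ κ₂
  have hκ0 : 0 ≤ κ := h10.trans (le_max_left _ _)
  have hκ1 : κ < 1 := max_lt h11 h21
  have hvκ : |v.im| ≤ κ * v.re := h12.trans (by gcongr; exact le_max_left _ _)
  have hwκ : |w.im| ≤ κ * w.re := h22.trans (by gcongr; exact le_max_right _ _)
  -- The real part of `z₂` is a sum of positive terms, so `z₂` stays in the sector of slope `κ`. In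
  -- `z₁` the terms have opposite signs and may cancel; near each end one term dominates, and `z₁`
  -- lies in the slightly wider sector of slope `κ'`.
  set κ' := (1 + κ) / 2 with hκ'
  have hκ'0 : 0 ≤ κ' := by positivity
  have hκ'1 : κ' < 1 := by rw [hκ']; linarith
  set z₁ : ℝ → ℂ := fun t => v * (√t : ℝ) - w * ((√t)⁻¹ : ℝ) with hz₁
  set z₂ : ℝ → ℂ := fun t => v * (√t : ℝ) + w * ((√t)⁻¹ : ℝ) with hz₂
  have re1 : ∀ t, (z₁ t).re = v.re * √t - w.re * (√t)⁻¹ := fun t => by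
    simp only [hz₁, Complex.sub_re, Complex.re_mul_ofReal]
  have re2 : ∀ t, (z₂ t).re = v.re * √t + w.re * (√t)⁻¹ := fun t => by
    simp only [hz₂, Complex.add_re, Complex.re_mul_ofReal]
  have imb : ∀ t, |v.im * √t| + |w.im * (√t)⁻¹| ≤ κ * (v.re * √t + w.re * (√t)⁻¹) := fun t => by
    rw [abs_mul, abs_mul, abs_of_nonneg (Real.sqrt_nonneg t),
      abs_of_nonneg (inv_nonneg.2 (Real.sqrt_nonneg t))]
    have := mul_le_mul_of_nonneg_right hvκ (Real.sqrt_nonneg t)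
    have := mul_le_mul_of_nonneg_right hwκ (inv_nonneg.2 (Real.sqrt_nonneg t))
    linarith
  have im1 : ∀ t, |(z₁ t).im| ≤ κ * (v.re * √t + w.re * (√t)⁻¹) := fun t => by
    refine le_trans ?_ (imb t)
    simp only [hz₁, Complex.sub_im, Complex.im_mul_ofReal]
    exact abs_sub _ _
  have im2 : ∀ t, |(z₂ t).im| ≤ κ * (v.re * √t + w.re * (√t)⁻¹) := fun t => by
    refine le_trans ?_ (imb t)
    simp only [hz₂, Complex.add_im, Complex.im_mul_ofReal]
    exact abs_add_le _ _
  have sq0 : Tendsto (fun t : ℝ => √t) (𝓝[>] 0) (𝓝[>] 0) := by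
    refine tendsto_nhdsWithin_iff.2 ⟨?_, ?_⟩
    · have : Tendsto (fun t : ℝ => √t) (𝓝 0) (𝓝 0) := by
        simpa using Real.continuous_sqrt.tendsto 0
      exact this.mono_left nhdsWithin_le_nhds
    · filter_upwards [self_mem_nhdsWithin] with t ht using Real.sqrt_pos.2 ht
  have inv0 : Tendsto (fun t : ℝ => (√t)⁻¹) (𝓝[>] 0) atTop := tendsto_inv_nhdsGT_zero.comp sq0
  have sqT : Tendsto (fun t : ℝ => √t) atTop atTop := Real.tendsto_sqrt_atTop
  have invT : Tendsto (fun t : ℝ => (√t)⁻¹) atTop (𝓝 0) := sqT.inv_tendsto_atTop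
  have sq0' : Tendsto (fun t : ℝ => √t) (𝓝[>] 0) (𝓝 0) := tendsto_nhdsWithin_iff.1 sq0 |>.1
  have A2 : Tendsto (fun t => (z₂ t).re) (𝓝[>] 0) atTop := by
    simp only [re2]
    exact (sq0'.const_mul v.re).add_atTop (inv0.const_mul_atTop hw0)
  have B2 : Tendsto (fun t => (z₂ t).re) atTop atTop := by
    simp only [re2]
    exact (sqT.const_mul_atTop hv0).atTop_add (invT.const_mul w.re)
  have A1 : Tendsto (fun t => (z₁ t).re) (𝓝[>] 0) atBot := by
    simp only [re1, sub_eq_add_neg]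
    exact (sq0'.const_mul v.re).add_atBot (tendsto_neg_atTop_atBot.comp (inv0.const_mul_atTop hw0))
  have B1 : Tendsto (fun t => (z₁ t).re) atTop atTop := by
    simp only [re1, sub_eq_add_neg]
    exact (sqT.const_mul_atTop hv0).atTop_add (invT.const_mul w.re).neg
  have S2 : ∀ᶠ t in 𝓝[>] (0 : ℝ), |(z₂ t).im| ≤ κ * |(z₂ t).re| :=
    Eventually.of_forall fun t => (im2 t).trans (by rw [← re2]; gcongr; exact le_abs_self _)
  have S2' : ∀ᶠ t in atTop, |(z₂ t).im| ≤ κ * |(z₂ t).re| :=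
    Eventually.of_forall fun t => (im2 t).trans (by rw [← re2]; gcongr; exact le_abs_self _)
  have hd : 0 < κ' - κ := by rw [hκ']; linarith
  have S1 : ∀ᶠ t in 𝓝[>] (0 : ℝ), |(z₁ t).im| ≤ κ' * |(z₁ t).re| := by
    have e1 := (inv0.const_mul_atTop (mul_pos hd hw0)).eventually_ge_atTop ((κ' + κ) * v.re)
    have e2 := sq0'.eventually_le_const (show (0 : ℝ) < 1 by norm_num)
    filter_upwards [e1, e2] with t h1 h2
    refine (im1 t).trans ?_
    have h3 : κ' * -(z₁ t).re ≤ κ' * |(z₁ t).re| := by gcongr; exact neg_le_abs _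
    refine le_trans ?_ h3
    rw [re1]
    have h4 : (κ' + κ) * v.re * √t ≤ (κ' + κ) * v.re * 1 := by gcongr
    nlinarith
  have S1' : ∀ᶠ t in atTop, |(z₁ t).im| ≤ κ' * |(z₁ t).re| := by
    have e1 := (sqT.const_mul_atTop (mul_pos hd hv0)).eventually_ge_atTop ((κ' + κ) * w.re)
    have e2 := invT.eventually_le_const (show (0 : ℝ) < 1 by norm_num)
    filter_upwards [e1, e2] with t h1 h2
    refine (im1 t).trans ?_
    have h3 : κ' * (z₁ t).re ≤ κ' * |(z₁ t).re| := by gcongr; exact le_abs_self _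
    refine le_trans ?_ h3
    rw [re1]
    have h4 : (κ' + κ) * w.re * (√t)⁻¹ ≤ (κ' + κ) * w.re * 1 := by gcongr
    nlinarith
  have Ltop := tendsto_gaussian_primitive_atTop hG
  have Lbot := tendsto_gaussian_primitive_atBot hG
  have G1 := tendsto_gaussian_primitive_of_sector hG hκ'0 hκ'1 S1 A1
    (tendsto_abs_atBot_atTop.comp A1) Lbot
  have G1' := tendsto_gaussian_primitive_of_sector hG hκ'0 hκ'1 S1' B1
    (tendsto_abs_atTop_atTop.comp B1) Ltop
  have G2 := tendsto_gaussian_primitive_of_sector hG hκ0 hκ1 S2 A2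
    (tendsto_abs_atTop_atTop.comp A2) Ltop
  have G2' := tendsto_gaussian_primitive_of_sector hG hκ0 hκ1 S2' B2
    (tendsto_abs_atTop_atTop.comp B2) Ltop
  set k : ℂ := (((√(2 * π))⁻¹ : ℝ) : ℂ) with hk
  -- An explicit primitive in `t`. Completing the square, `exp(∓vw) exp(-(v√t ∓ w/√t)²/2)` is the
  -- same exponential `exp(-ut - w²/(2t))` for both signs; in the difference the `v`-terms cancel
  -- and the `w`-terms add. Between the ends only `G (z₁ t)` changes limit, by `√(2π)`.
  have hder : ∀ t ∈ Ioi (0 : ℝ), HasDerivAt (fun t => k * (Complex.exp (-(v * w)) * G (z₁ t) -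
      Complex.exp (v * w) * G (z₂ t)))
      (Complex.exp (-u * t) * (w * (((√(2 * π) * (t * √t))⁻¹ : ℝ) : ℂ) *
      Complex.exp (-w ^ 2 / (2 * t)))) t := by
    intro t ht
    have ht : 0 < t := ht
    have hs0 : 0 < √t := Real.sqrt_pos.2 ht
    have hsq : HasDerivAt (fun t : ℝ => ((√t : ℝ) : ℂ)) ((1 / (2 * √t) : ℝ) : ℂ) t :=
      (Real.hasDerivAt_sqrt ht.ne').ofReal_comp
    have hin : HasDerivAt (fun t : ℝ => (((√t)⁻¹ : ℝ) : ℂ))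
        ((-(1 / (2 * √t)) / (√t) ^ 2 : ℝ) : ℂ) t :=
      ((Real.hasDerivAt_sqrt ht.ne').inv hs0.ne').ofReal_comp
    have d1 : HasDerivAt z₁ _ t := (hsq.const_mul v).sub (hin.const_mul w)
    have d2 : HasDerivAt z₂ _ t := (hsq.const_mul v).add (hin.const_mul w)
    have g1 := ((hG (z₁ t)).comp t d1).const_mul (Complex.exp (-(v * w)))
    have g2 := ((hG (z₂ t)).comp t d2).const_mul (Complex.exp (v * w))
    refine ((g1.sub g2).const_mul k).congr_deriv ?_
    set s := √t with hs
    have hts : t = s ^ 2 := (Real.sq_sqrt ht.le).symm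
    have hsC : (s : ℂ) ≠ 0 := by exact_mod_cast hs0.ne'
    have e1 : Complex.exp (-(v * w)) * Complex.exp (-(z₁ t) ^ 2 / 2) =
        Complex.exp (-u * t) * Complex.exp (-w ^ 2 / (2 * t)) := by
      rw [← Complex.exp_add, ← Complex.exp_add]
      congr 1
      simp only [hz₁, ← hs]
      rw [show -u = -(v ^ 2) / 2 by rw [huv]; ring, hts]
      push_cast; field_simp; ring
    have e2 : Complex.exp (v * w) * Complex.exp (-(z₂ t) ^ 2 / 2) =
        Complex.exp (-u * t) * Complex.exp (-w ^ 2 / (2 * t)) := by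
      rw [← Complex.exp_add, ← Complex.exp_add]
      congr 1
      simp only [hz₂, ← hs]
      rw [show -u = -(v ^ 2) / 2 by rw [huv]; ring, hts]
      push_cast; field_simp; ring
    simp only [← mul_assoc]
    rw [e1, e2, hk, mul_inv]
    have e3 : (t : ℂ) = s ^ 2 := by rw [hts]; push_cast; rfl
    push_cast
    rw [e3]
    field_simp
    ring
  rw [integral_Ioi_of_hasDerivAt_of_tendsto_nhdsGT hder
    (integrableOn_subordinator hu (re_sq_div_two_pos_of_abs_im_lt hw))
    (((G1.const_mul _).sub (G2.const_mul _)).const_mul k)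
    (((G1'.const_mul _).sub (G2'.const_mul _)).const_mul k)]
  have hk1 : k * ((√(2 * π) : ℝ) : ℂ) = 1 := by
    rw [hk, ← Complex.ofReal_mul, inv_mul_cancel₀ (by positivity)]; simp
  push_cast
  linear_combination Complex.exp (-(v * w)) * hk1

/-! ### The density as a contour integral -/

/-- The integrand of the contour integral for the Hartman-Watson density at time `t`. -/
noncomputable def hartmanWatsonKernel (r t : ℝ) (w : ℂ) : ℂ :=
  w * Complex.exp (r * Complex.cosh w) * Complex.exp (-w ^ 2 / (2 * t))

/-- The Hartman-Watson density as a contour integral; any `a ≥ π` in place of `4` gives the same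
value. -/
noncomputable def hartmanWatsonDensity (r t : ℝ) : ℝ :=
  (besselI0 r)⁻¹ * ((√(2 * π) * (t * √t))⁻¹ *
    (hankelIntegral 4 (hartmanWatsonKernel r t)).re)

lemma differentiable_hartmanWatsonKernel (r t : ℝ) :
    Differentiable ℂ (hartmanWatsonKernel r t) := by
  unfold hartmanWatsonKernel
  fun_prop

lemma hartmanWatsonKernel_conj (r t : ℝ) (w : ℂ) :
    hartmanWatsonKernel r t ((starRingEnd ℂ) w) =
      (starRingEnd ℂ) (hartmanWatsonKernel r t w) := by
  unfold hartmanWatsonKernel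
  simp only [map_mul, ← Complex.exp_conj, map_div₀, map_neg, map_pow, Complex.conj_ofReal,
    ← Complex.cosh_conj, map_ofNat]

lemma ofReal_hankelIntegral_re (a r t : ℝ) :
    ((hankelIntegral a (hartmanWatsonKernel r t)).re : ℂ) =
      hankelIntegral a (hartmanWatsonKernel r t) := by
  have h := hankelIntegral_im_eq_zero (a := a) (hartmanWatsonKernel_conj r t)
  exact Complex.ext (by simp) (by simp [h])

lemma re_sq_ge {a : ℝ} (ha : π ≤ a) {w : ℂ} (h : a ≤ w.re) (h' : |w.im| ≤ π) :
    a ^ 2 - π ^ 2 ≤ (w ^ 2).re := by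
  rw [sq w, Complex.mul_re]
  have h1 : w.im ^ 2 ≤ π ^ 2 := by rw [← sq_abs w.im]; gcongr
  have h2 : a ^ 2 ≤ w.re ^ 2 := by
    have : 0 ≤ a := pi_pos.le.trans ha
    gcongr
  nlinarith

lemma re_neg_sq_div (t : ℝ) (w : ℂ) : (-w ^ 2 / (2 * t)).re = -((w ^ 2).re / (2 * t)) := by
  have h : -w ^ 2 / (2 * (t : ℂ)) = (((2 * t)⁻¹ : ℝ) : ℂ) * -(w ^ 2) := by
    push_cast; rw [div_eq_mul_inv]; ring
  rw [h, Complex.re_ofReal_mul, Complex.neg_re, div_eq_mul_inv]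
  ring

lemma norm_exp_neg_sq_div_le_one {a t : ℝ} (ha : π ≤ a) (ht : 0 < t) {w : ℂ} (h : a ≤ w.re)
    (h' : |w.im| ≤ π) : ‖Complex.exp (-w ^ 2 / (2 * t))‖ ≤ 1 := by
  rw [Complex.norm_exp, Real.exp_le_one_iff, re_neg_sq_div, neg_nonpos]
  have := re_sq_ge ha h h'
  have : 0 ≤ a ^ 2 - π ^ 2 := by nlinarith [pi_pos]
  exact div_nonneg (by linarith) (by positivity)

lemma norm_mul_exp_mul_cosh_le {r a : ℝ} (hr : 0 < r) {w : ℂ} (h : a ≤ w.re) :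
    ‖w * Complex.exp (r * Complex.cosh w)‖ ≤
      rexp (r / 2 * rexp (-a)) * rexp (r / 2 * (Complex.exp w).re + 1 * ‖w‖) := by
  rw [norm_mul, Real.exp_add, one_mul]
  have h1 := norm_exp_mul_cosh_le hr h
  have h2 : ‖w‖ ≤ rexp ‖w‖ := by linarith [Real.add_one_le_exp ‖w‖]
  calc _ ≤ rexp ‖w‖ * (rexp (r / 2 * rexp (-a)) * rexp (r / 2 * (Complex.exp w).re)) := by gcongr
    _ = _ := by ring

lemma integrable_mul_exp_mul_cosh {r : ℝ} (hr : 0 < r) (a : ℝ) :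
    Integrable (fun s => hankelPath a s * Complex.exp (r * Complex.cosh (hankelPath a s))) :=
  integrable_comp_hankelPath (g := fun w => w * Complex.exp (r * Complex.cosh w))
    (half_pos hr) (by fun_prop) fun _ h _ => norm_mul_exp_mul_cosh_le hr h

lemma integrable_hartmanWatsonKernel {r a t : ℝ} (hr : 0 < r) (ha : π ≤ a) (ht : 0 < t) :
    Integrable (fun s => hartmanWatsonKernel r t (hankelPath a s)) := by
  refine integrable_comp_hankelPath (half_pos hr)
    (differentiable_hartmanWatsonKernel r t).continuous (R := 1) (K := rexp (r / 2 * rexp (-a)))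
    fun w h h' => ?_
  rw [hartmanWatsonKernel, norm_mul]
  exact (mul_le_of_le_one_right (norm_nonneg _) (norm_exp_neg_sq_div_le_one ha ht h h')).trans
    (norm_mul_exp_mul_cosh_le hr h)

/-- This frees the abscissa to depend on `t`, which lets the contour pass through the saddle. -/
lemma hartmanWatsonDensity_eq {r a t : ℝ} (hr : 0 < r) (ha : π ≤ a) (ht : 0 < t) :
    hartmanWatsonDensity r t = (besselI0 r)⁻¹ * ((√(2 * π) * (t * √t))⁻¹ *
      (hankelIntegral a (hartmanWatsonKernel r t)).re) := by
  rw [hartmanWatsonDensity, hankelIntegral_shift (differentiable_hartmanWatsonKernel r t)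
    (integrable_hartmanWatsonKernel hr (by linarith [pi_lt_four]) ht)
    (integrable_hartmanWatsonKernel hr ha ht)]

lemma continuousOn_hartmanWatsonDensity {r : ℝ} (hr : 0 < r) :
    ContinuousOn (hartmanWatsonDensity r) (Ioi 0) := by
  unfold hartmanWatsonDensity
  have h4 : π ≤ 4 := pi_lt_four.le
  have hc : ContinuousOn (fun t => hankelIntegral 4 (hartmanWatsonKernel r t)) (Ioi 0) := by
    unfold hankelIntegral
    refine continuousOn_const.mul ?_
    refine continuousOn_of_dominated (bound := fun s =>
      ‖hankelPath 4 s * Complex.exp (r * Complex.cosh (hankelPath 4 s))‖) ?_ ?_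
      (integrable_mul_exp_mul_cosh hr 4).norm ?_
    · exact fun t ht => (Integrable.hankelWeight_mul
        (integrable_hartmanWatsonKernel hr h4 ht)).aestronglyMeasurable
    · refine fun t ht => ae_of_all _ fun s => ?_
      rw [norm_mul, norm_hankelWeight, one_mul, hartmanWatsonKernel, norm_mul]
      exact mul_le_of_le_one_right (norm_nonneg _) (norm_exp_neg_sq_div_le_one h4 ht
        (le_hankelPath_re 4 s) (abs_hankelPath_im_le 4 s))
    · refine ae_of_all _ fun s => continuousOn_const.mul (continuousOn_const.mul ?_)
      refine Complex.continuous_exp.comp_continuousOn (continuousOn_const.div (by fun_prop) ?_)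
      intro t ht
      have : (t : ℂ) ≠ 0 := by exact_mod_cast (ne_of_gt ht)
      simpa using this
  refine continuousOn_const.mul (ContinuousOn.mul ?_ (Complex.continuous_re.comp_continuousOn hc))
  refine ContinuousOn.inv₀ (by fun_prop) fun t ht => ?_
  have ht : 0 < t := ht
  positivity

lemma sqrt_two_mul_spec {u : ℂ} (hu : 0 < u.re) :
    ((2 * u) ^ (1 / 2 : ℂ)) ^ 2 = 2 * u ∧
      |((2 * u) ^ (1 / 2 : ℂ)).im| < ((2 * u) ^ (1 / 2 : ℂ)).re := by
  set v := (2 * u) ^ (1 / 2 : ℂ) with hv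
  have hu0 : u ≠ 0 := by rintro rfl; simp at hu
  have hsq : v ^ 2 = 2 * u := by
    rw [hv, one_div]; exact Complex.cpow_nat_inv_pow _ two_ne_zero
  refine ⟨hsq, ?_⟩
  have hre : v.re ^ 2 - v.im ^ 2 = 2 * u.re := by
    have := congrArg Complex.re hsq
    rw [sq, Complex.mul_re] at this
    simp at this
    linarith
  -- The principal root has argument in `[-π/2, π/2]`. Together with `Re v² = 2 Re u > 0` this
  -- places `v` in the open sector.
  have hpos : 0 ≤ v.re := by
    rw [hv, Complex.cpow_def_of_ne_zero (by simpa using hu0), Complex.exp_re]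
    refine mul_nonneg (Real.exp_pos _).le (Real.cos_nonneg_of_mem_Icc ?_)
    have h1 : (Complex.log (2 * u) * (1 / 2 : ℂ)).im = Complex.arg (2 * u) / 2 := by
      rw [show (1 / 2 : ℂ) = ((1 / 2 : ℝ) : ℂ) by push_cast; rfl, Complex.im_mul_ofReal,
        Complex.log_im]
      ring
    rw [h1]
    constructor
    · linarith [Complex.neg_pi_lt_arg (2 * u)]
    · linarith [Complex.arg_le_pi (2 * u)]
  refine abs_lt_of_sq_lt_sq ?_ hpos
  linarith

/-- The integrand of the double integral whose iterated integrals are the Laplace transform of the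
density and Schläfli's integral. -/
noncomputable def laplaceKernel (r : ℝ) (u : ℂ) (p : ℝ × ℝ) : ℂ :=
  hankelWeight p.1 * Complex.exp (r * Complex.cosh (hankelPath 4 p.1)) *
    (Complex.exp (-u * p.2) * (hankelPath 4 p.1 * (((√(2 * π) * (p.2 * √p.2))⁻¹ : ℝ) : ℂ) *
      Complex.exp (-(hankelPath 4 p.1) ^ 2 / (2 * p.2))))

lemma integrable_laplaceKernel {r : ℝ} (hr : 0 < r) {u : ℂ} (hu : 0 < u.re) :
    Integrable (laplaceKernel r u) (volume.prod (volume.restrict (Ioi (0 : ℝ)))) := by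
  -- A lower bound for `Re w²` on the contour, positive because `4 > π`. It makes `t^(-3/2)
  -- exp(-w²/(2t))` bounded uniformly in `w`, so a product of integrable functions dominates.
  set c : ℝ := 4 ^ 2 - π ^ 2 with hc
  have hc0 : 0 < c := by nlinarith [pi_lt_four, pi_pos]
  have hb := (integrable_mul_exp_mul_cosh hr 4).norm.mul_prod (integrableOn_exp_neg_mul hu
    ((√(2 * π))⁻¹ * (1 / (c / 2) + 2 / (c / 2) ^ 2)))
  refine hb.mono' ?_ ?_
  · have h1 := measurable_hankelWeight
    have h2 := (continuous_hankelPath 4).measurable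
    refine Measurable.aestronglyMeasurable ?_
    unfold laplaceKernel
    have h3 : Measurable fun w : ℂ => Complex.cosh w := Complex.continuous_cosh.measurable
    fun_prop
  · have hae : ∀ᵐ p ∂((volume : Measure ℝ).prod (volume.restrict (Ioi (0 : ℝ)))), 0 < p.2 :=
      Measure.quasiMeasurePreserving_snd.ae (ae_restrict_mem measurableSet_Ioi)
    filter_upwards [hae] with p hp
    rw [laplaceKernel, norm_mul, norm_mul, norm_hankelWeight, one_mul, norm_mul (hankelPath 4 p.1)]
    have := norm_subordinator_integrand_le (u := u) hc0 (re_sq_ge pi_lt_four.le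
      (le_hankelPath_re 4 p.1) (abs_hankelPath_im_le 4 p.1)) hp
    calc _ ≤ ‖Complex.exp (r * Complex.cosh (hankelPath 4 p.1))‖ * (‖hankelPath 4 p.1‖ *
          ((√(2 * π))⁻¹ * (1 / (c / 2) + 2 / (c / 2) ^ 2) * rexp (-(u.re * p.2)))) := by gcongr
      _ = _ := by ring

lemma exp_mul_hartmanWatsonDensity (r : ℝ) (u : ℂ) (t : ℝ) :
    Complex.exp (-u * t) * (hartmanWatsonDensity r t : ℂ) =
      (besselI 0 r)⁻¹ * (1 / (2 * π)) * ∫ s, laplaceKernel r u (s, t) := by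
  rw [hartmanWatsonDensity, Complex.ofReal_mul, Complex.ofReal_mul, ofReal_hankelIntegral_re,
    Complex.ofReal_inv (besselI0 r), ofReal_besselI0, hankelIntegral]
  have : ∀ s, laplaceKernel r u (s, t) = Complex.exp (-u * t) *
      (((√(2 * π) * (t * √t))⁻¹ : ℝ) : ℂ) *
      (hankelWeight s * hartmanWatsonKernel r t (hankelPath 4 s)) := by
    intro s
    simp only [laplaceKernel, hartmanWatsonKernel]
    ring
  simp only [this]
  rw [integral_const_mul]
  ring

lemma isHartmanWatsonDensity_hartmanWatsonDensity {r : ℝ} (hr : 0 < r) :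
    IsHartmanWatsonDensity r (hartmanWatsonDensity r) where
  continuousOn := continuousOn_hartmanWatsonDensity hr
  integrableOn u hu := by
    simp only [exp_mul_hartmanWatsonDensity]
    exact (integrable_laplaceKernel hr hu).integral_prod_right.const_mul _
  laplace u hu := by
    simp only [exp_mul_hartmanWatsonDensity]
    have hswap := integral_integral_swap (f := fun s t => laplaceKernel r u (s, t))
      (integrable_laplaceKernel hr hu)
    rw [integral_const_mul, ← hswap,
      ← hankelIntegral_besselKernel hr 4 ((2 * u) ^ (1 / 2 : ℂ)), hankelIntegral]
    obtain ⟨hv, hv'⟩ := sqrt_two_mul_spec hu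
    have : ∀ s, ∫ t in Ioi (0 : ℝ), laplaceKernel r u (s, t) =
        hankelWeight s * besselKernel r ((2 * u) ^ (1 / 2 : ℂ)) (hankelPath 4 s) := by
      intro s
      simp only [laplaceKernel]
      have hw : |(hankelPath 4 s).im| < (hankelPath 4 s).re :=
        (abs_hankelPath_im_le 4 s).trans_lt (pi_lt_four.trans_le (le_hankelPath_re 4 s))
      rw [integral_const_mul, integral_subordinator hu hv hv' hw, besselKernel, sub_eq_add_neg,
        Complex.exp_add]
      ring
    simp only [this]
    ring

/-! ### Uniqueness of the density -/

/-- On the line `Re u = 1` the Laplace transform of the difference is the Fourier transform of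
`exp(-t)(f - g)`. It vanishes, and inversion at points of continuity gives `f = g`. -/
lemma IsHartmanWatsonDensity.eqOn {r : ℝ} {f g : ℝ → ℝ} (hf : IsHartmanWatsonDensity r f)
    (hg : IsHartmanWatsonDensity r g) : EqOn f g (Ioi 0) := by
  set h : ℝ → ℂ := (Ioi 0).indicator
    (fun t => Complex.exp (-1 * (t : ℂ)) * (f t : ℂ) - Complex.exp (-1 * (t : ℂ)) * (g t : ℂ))
    with hh
  have hint : Integrable h :=
    (integrable_indicator_iff measurableSet_Ioi).2
      ((hf.integrableOn 1 (by simp)).sub (hg.integrableOn 1 (by simp)))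
  have hF : FourierTransform.fourier h = 0 := by
    funext ξ
    rw [Real.fourier_real_eq_integral_exp_smul]
    have hu : 0 < (1 + 2 * π * ξ * Complex.I : ℂ).re := by simp
    have h1 : ∀ t : ℝ, Complex.exp (((-2 * π * t * ξ : ℝ) : ℂ) * Complex.I) • h t =
        (Ioi 0).indicator (fun t : ℝ =>
          Complex.exp (-(1 + 2 * π * ξ * Complex.I) * (t : ℂ)) * (f t : ℂ) -
          Complex.exp (-(1 + 2 * π * ξ * Complex.I) * (t : ℂ)) * (g t : ℂ)) t := by
      intro t
      rw [hh]
      by_cases ht : t ∈ Ioi (0 : ℝ)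
      · rw [indicator_of_mem ht, indicator_of_mem ht, smul_eq_mul, mul_sub, ← mul_assoc,
          ← mul_assoc, ← Complex.exp_add]
        have : ((-2 * π * t * ξ : ℝ) : ℂ) * Complex.I + -1 * (t : ℂ) =
          -(1 + 2 * π * ξ * Complex.I) * (t : ℂ) := by push_cast; ring
        rw [this]
      · rw [indicator_of_notMem ht, indicator_of_notMem ht, smul_zero]
    simp only [h1]
    rw [integral_indicator measurableSet_Ioi, integral_sub (hf.integrableOn _ hu)
      (hg.integrableOn _ hu), hf.laplace _ hu, hg.laplace _ hu, sub_self]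
    rfl
  intro t ht
  have hcont : ContinuousAt h t := by
    have hc : ContinuousOn (fun t : ℝ => Complex.exp (-1 * (t : ℂ)) * (f t : ℂ) -
        Complex.exp (-1 * (t : ℂ)) * (g t : ℂ)) (Ioi 0) := by
      have h1 := Complex.continuous_ofReal.comp_continuousOn hf.continuousOn
      have h2 := Complex.continuous_ofReal.comp_continuousOn hg.continuousOn
      exact (ContinuousOn.mul (by fun_prop) h1).sub (ContinuousOn.mul (by fun_prop) h2)
    refine (hc.continuousAt (isOpen_Ioi.mem_nhds ht)).congr ?_
    filter_upwards [isOpen_Ioi.mem_nhds ht] with x hx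
    rw [hh, indicator_of_mem hx]
  have hinv := hint.fourierInv_fourier_eq (by rw [hF]; exact integrable_zero _ _ _) hcont
  rw [hF] at hinv
  have h0 : h t = 0 := by
    rw [← hinv, Real.fourierInv_eq']
    simp
  rw [hh, indicator_of_mem ht, ← mul_sub] at h0
  have := (mul_eq_zero.1 h0).resolve_left (Complex.exp_ne_zero _)
  exact_mod_cast sub_eq_zero.1 this

/-! ### The saddle point equation and its largest solution -/

/-- The right-hand side of the saddle point equation. -/
noncomputable def saddleTime (r u : ℝ) : ℝ :=
  Real.log u / (2 * √(2 * u)) - rhoParam r / √(2 * u) + 1 / (4 * u)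

lemma half_log_sub_rhoParam {r u ν : ℝ} (hr : 0 < r) (hν : 0 < ν) (hu : u = ν ^ 2 / 2) :
    Real.log u - 2 * rhoParam r = 2 * Real.log (2 * ν / r) := by
  have h2 : Real.log (√2) = Real.log 2 / 2 := Real.log_sqrt (by norm_num)
  rw [hu, rhoParam, Real.log_div (by positivity) (by norm_num), Real.log_pow,
    Real.log_div (by positivity) (by positivity), Real.log_mul (by norm_num) (by positivity),
    Real.log_div (by positivity) (by positivity), Real.log_mul (by norm_num) (by positivity), h2]
  push_cast; ring

lemma saddleTime_eq {r u ν : ℝ} (hr : 0 < r) (hν : 0 < ν) (hu : u = ν ^ 2 / 2) :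
    saddleTime r u = Real.log (2 * ν / r) / ν + 1 / (2 * ν ^ 2) := by
  have h := half_log_sub_rhoParam hr hν hu
  have h1 : √(2 * u) = ν := by
    rw [hu, mul_div_cancel₀ _ two_ne_zero, Real.sqrt_sq hν.le]
  rw [saddleTime, h1, show Real.log u = 2 * rhoParam r + 2 * Real.log (2 * ν / r) by linarith, hu]
  field_simp
  ring

lemma continuousOn_saddleTime (r : ℝ) : ContinuousOn (saddleTime r) (Ioi 0) := by
  unfold saddleTime
  have h0 : ∀ u ∈ Ioi (0 : ℝ), √(2 * u) ≠ 0 := fun u hu =>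
    (Real.sqrt_pos.2 (mul_pos two_pos hu)).ne'
  have h1 : ContinuousOn Real.log (Ioi 0) :=
    Real.continuousOn_log.mono fun u hu => ne_of_gt hu
  refine ((h1.div (by fun_prop) fun u hu => mul_ne_zero two_ne_zero (h0 u hu)).sub
    (continuousOn_const.div (by fun_prop) h0)).add (continuousOn_const.div (by fun_prop) ?_)
  intro u hu
  exact mul_ne_zero four_ne_zero (ne_of_gt hu)

lemma tendsto_sqrt_two_mul_atTop : Tendsto (fun u : ℝ => √(2 * u)) atTop atTop :=
  Real.tendsto_sqrt_atTop.comp (tendsto_id.const_mul_atTop two_pos)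

lemma saddleTime_eventually_eq {r : ℝ} (hr : 0 < r) :
    saddleTime r =ᶠ[atTop]
      fun u => Real.log (2 * √(2 * u) / r) / √(2 * u) + 1 / (2 * √(2 * u) ^ 2) := by
  filter_upwards [eventually_gt_atTop 0] with u hu
  refine saddleTime_eq hr (by positivity) ?_
  rw [Real.sq_sqrt (by positivity)]; ring

lemma tendsto_log_two_mul_div_atTop {r : ℝ} (hr : 0 < r) :
    Tendsto (fun ν : ℝ => Real.log (2 * ν / r)) atTop atTop := by
  refine Real.tendsto_log_atTop.comp ?_
  exact (tendsto_id.const_mul_atTop two_pos).atTop_div_const hr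

lemma tendsto_log_two_mul_div_div_atTop {r : ℝ} (hr : 0 < r) :
    Tendsto (fun ν : ℝ => Real.log (2 * ν / r) / ν + 1 / (2 * ν ^ 2)) atTop (𝓝 0) := by
  have h1 : Tendsto (fun ν : ℝ => Real.log (2 * ν / r) / ν) atTop (𝓝 0) := by
    have h := (Real.tendsto_pow_log_div_mul_add_atTop (r / 2) 0 1 (by positivity)).comp
      ((tendsto_id.const_mul_atTop two_pos).atTop_div_const hr)
    refine h.congr fun ν => ?_
    simp only [Function.comp, id, pow_one, add_zero]
    congr 1
    field_simp
  have h2 : Tendsto (fun ν : ℝ => 1 / (2 * ν ^ 2)) atTop (𝓝 0) := by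
    refine Tendsto.const_div_atTop ?_ 1
    exact (tendsto_pow_atTop two_ne_zero).const_mul_atTop two_pos
  simpa using h1.add h2

lemma tendsto_saddleTime_atTop {r : ℝ} (hr : 0 < r) : Tendsto (saddleTime r) atTop (𝓝 0) :=
  ((tendsto_log_two_mul_div_div_atTop hr).comp tendsto_sqrt_two_mul_atTop).congr'
    (saddleTime_eventually_eq hr).symm

lemma eventually_saddleTime_pos {r : ℝ} (hr : 0 < r) : ∀ᶠ u in atTop, 0 < saddleTime r u := by
  filter_upwards [saddleTime_eventually_eq hr, tendsto_sqrt_two_mul_atTop.eventually_gt_atTop 0,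
    ((tendsto_log_two_mul_div_atTop hr).comp tendsto_sqrt_two_mul_atTop).eventually_gt_atTop 0]
    with u h1 h2 h3
  have h3 : 0 < Real.log (2 * √(2 * u) / r) := h3
  rw [h1]
  positivity

/-- No monotonicity is needed. The right-hand side is positive at some large `W` and tends to `0`,
so for `t` below its value at `W` all solutions beyond `W` lie in a compact interval `[W, V]`; one
exists there by the intermediate value theorem, and the closed solution set has a maximum. -/
lemma eventually_isGreatest_saddleSolutions {r : ℝ} (hr : 0 < r) (U : ℝ) :
    ∀ᶠ t in 𝓝[>] (0 : ℝ), IsGreatest (saddleSolutions r t) (saddlePoint r t) ∧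
      U ≤ saddlePoint r t := by
  obtain ⟨W, hW1, hW2⟩ := ((eventually_saddleTime_pos hr).and
    (eventually_ge_atTop (max U 1))).exists
  have hW0 : 0 < W := lt_of_lt_of_le one_pos ((le_max_right _ _).trans hW2)
  filter_upwards [Ioo_mem_nhdsGT hW1] with t ht
  obtain ⟨V, hV⟩ := eventually_atTop.1
    (((tendsto_saddleTime_atTop hr).eventually_lt_const ht.1).and (eventually_ge_atTop W))
  have hWV : W ≤ V := (hV V le_rfl).2
  have hcont : ContinuousOn (saddleTime r) (Icc W V) :=
    (continuousOn_saddleTime r).mono fun u hu => lt_of_lt_of_le hW0 hu.1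
  have hcpt : IsCompact (Icc W V ∩ saddleTime r ⁻¹' {t}) :=
    isCompact_Icc.of_isClosed_subset
      (hcont.preimage_isClosed_of_isClosed isClosed_Icc isClosed_singleton) inter_subset_left
  have hne : (Icc W V ∩ saddleTime r ⁻¹' {t}).Nonempty := by
    obtain ⟨u, hu, hut⟩ := intermediate_value_Icc' hWV hcont
      ⟨(hV V le_rfl).1.le, ht.2.le⟩
    exact ⟨u, hu, hut⟩
  obtain ⟨s, hs, hmax⟩ := hcpt.exists_isGreatest hne
  have hgr : IsGreatest (saddleSolutions r t) s := by
    refine ⟨⟨lt_of_lt_of_le hW0 hs.1.1, (show saddleTime r s = t from hs.2).symm⟩, ?_⟩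
    rintro u ⟨hu0, hut⟩
    have hut' : saddleTime r u = t := hut.symm
    rcases le_total u W with h | h
    · exact h.trans hs.1.1
    · refine hmax ⟨⟨h, ?_⟩, hut'⟩
      by_contra hcon
      exact (hV u (not_le.1 hcon).le).1.ne hut'
  have hsup : saddlePoint r t = s := hgr.csSup_eq
  rw [hsup]
  exact ⟨hgr, (le_max_left _ _).trans (hW2.trans hs.1.1)⟩

lemma tendsto_saddlePoint {r : ℝ} (hr : 0 < r) :
    Tendsto (saddlePoint r) (𝓝[>] 0) atTop :=
  tendsto_atTop.2 fun U => (eventually_isGreatest_saddleSolutions hr U).mono fun _ h => h.2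

/-! ### Elementary estimates for the Gaussian approximation -/

lemma norm_cexp_sub_cexp_le {A B : ℂ} {m : ℝ} (hA : A.re ≤ m) (hB : B.re ≤ m) :
    ‖Complex.exp A - Complex.exp B‖ ≤ rexp m * ‖A - B‖ := by
  have hconv : Convex ℝ {z : ℂ | z.re ≤ m} := convex_halfSpace_re_le m
  refine hconv.norm_image_sub_le_of_norm_hasDerivWithin_le
    (fun z _ => (Complex.hasDerivAt_exp z).hasDerivWithinAt) (fun z hz => ?_) hB hA
  rw [Complex.norm_exp]
  exact Real.exp_le_exp.2 hz

lemma abs_cos_sub_one_add_sq_le (y : ℝ) : |Real.cos y - 1 + y ^ 2 / 2| ≤ 2 * |y| ^ 3 := by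
  have h0 := Real.one_sub_sq_div_two_le_cos (x := y)
  rw [abs_of_nonneg (by linarith)]
  have hy := abs_nonneg y
  rcases le_total |y| 1 with h | h
  · have := (abs_le.1 (Real.cos_bound h)).2
    have h4 : |y| ^ 4 ≤ |y| ^ 3 := pow_le_pow_of_le_one hy h (by norm_num)
    have : 0 ≤ |y| ^ 3 := by positivity
    linarith
  · have h1 := Real.cos_le_one y
    have h2 : y ^ 2 = |y| ^ 2 := (sq_abs y).symm
    have h3 : |y| ^ 2 ≤ |y| ^ 3 := pow_le_pow_right₀ h (by norm_num)
    have : 0 ≤ |y| ^ 2 := by positivity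
    linarith

lemma abs_sin_sub_self_le (y : ℝ) : |Real.sin y - y| ≤ 2 * |y| ^ 3 := by
  have hy := abs_nonneg y
  rcases le_total |y| 1 with h | h
  · have h1 := Real.sin_bound h
    have h4 : |y| ^ 5 ≤ |y| ^ 3 := pow_le_pow_of_le_one hy h (by norm_num)
    have h5 : 0 ≤ |y| ^ 3 := by positivity
    have h6 : Real.sin y - y = (Real.sin y - (y - y ^ 3 / 6)) + -(y ^ 3 / 6) := by ring
    have h7 : |-(y ^ 3 / 6)| = |y| ^ 3 / 6 := by rw [abs_neg, abs_div, abs_pow]; norm_num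
    rw [h6]
    refine (abs_add_le _ _).trans ?_
    rw [h7]; linarith
  · have h3 : |y| ≤ |y| ^ 3 := by
      simpa using pow_le_pow_right₀ h (show 1 ≤ 3 by norm_num)
    have h4 : |Real.sin y| ≤ |y| := Real.abs_sin_le_abs
    exact (abs_sub _ _).trans (by linarith)

lemma integral_Ioi_mul_exp_neg_mul_sq {β : ℝ} (hβ : 0 < β) (a : ℝ) :
    ∫ x in Ioi a, x * rexp (-β * x ^ 2) = rexp (-β * a ^ 2) / (2 * β) := by
  have h := integral_Ioi_of_hasDerivAt_of_tendsto' (a := a) (m := 0)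
    (f := fun x => -(rexp (-β * x ^ 2) / (2 * β))) (f' := fun x => x * rexp (-β * x ^ 2)) ?_ ?_ ?_
  · rw [h]; ring
  · intro x _
    have h1 : HasDerivAt (fun x : ℝ => -β * x ^ 2) (-β * (2 * x)) x := by
      simpa using (hasDerivAt_pow 2 x).const_mul (-β)
    refine (h1.exp.div_const (2 * β)).neg.congr_deriv ?_
    field_simp
  · exact (integrable_mul_exp_neg_mul_sq hβ).integrableOn
  · have : Tendsto (fun x : ℝ => -β * x ^ 2) atTop atBot :=
      (tendsto_pow_atTop two_ne_zero).const_mul_atTop_of_neg (by linarith)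
    simpa using ((tendsto_exp_atBot.comp this).div_const (2 * β)).neg

lemma integral_abs_mul_exp_neg_mul_sq {β : ℝ} (hβ : 0 < β) :
    ∫ x : ℝ, |x| * rexp (-β * x ^ 2) = 1 / β := by
  have h := integral_comp_abs (f := fun x => x * rexp (-β * x ^ 2))
  simp only [sq_abs] at h
  rw [h, integral_Ioi_mul_exp_neg_mul_sq hβ]
  simp; field_simp

lemma integrable_abs_mul_exp_neg_mul_sq {β : ℝ} (hβ : 0 < β) :
    Integrable fun x : ℝ => |x| * rexp (-β * x ^ 2) := by
  refine (integrable_mul_exp_neg_mul_sq hβ).norm.congr (ae_of_all _ fun x => ?_)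
  simp

/-- Half of the Gaussian decay absorbs the polynomial: with `x = ν y²/20` the claim reduces to `120
x + 3 ≤ 123 exp x`. -/
lemma mul_sq_add_mul_exp_le {ν : ℝ} (y : ℝ) :
    (6 * (ν * y ^ 2) + 3) * rexp (-(ν / 10 * y ^ 2)) ≤ 123 * rexp (-(ν / 20) * y ^ 2) := by
  have h1 := Real.add_one_le_exp (ν / 20 * y ^ 2)
  have h2 : rexp (-(ν / 10 * y ^ 2)) = rexp (-(ν / 20) * y ^ 2) * (rexp (ν / 20 * y ^ 2))⁻¹ := by
    rw [← Real.exp_neg, ← Real.exp_add]; ring_nf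
  rw [h2]
  have h3 : (6 * (ν * y ^ 2) + 3) ≤ 123 * rexp (ν / 20 * y ^ 2) := by
    nlinarith [Real.exp_pos (ν / 20 * y ^ 2)]
  have h4 := Real.exp_pos (ν / 20 * y ^ 2)
  calc _ ≤ 123 * rexp (ν / 20 * y ^ 2) *
        (rexp (-(ν / 20) * y ^ 2) * (rexp (ν / 20 * y ^ 2))⁻¹) := by gcongr
    _ = _ := by field_simp

/-! ### Parameters at the saddle -/

/-- The parameters of the saddle point approximation: `ν = √(2 u₀(t))`, `a = log (2 ν / r)`. -/
structure SaddleData (r a ν t : ℝ) : Prop where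
  r_pos : 0 < r
  a_ge : 10 ≤ a
  ν_ge : 1 ≤ ν
  ν_eq : ν = r / 2 * rexp a
  quotient_le : r ^ 2 / (4 * ν) ≤ 1 / 2
  t_eq : t = a / ν + 1 / (2 * ν ^ 2)

namespace SaddleData
variable {r a ν t : ℝ} (h : SaddleData r a ν t)
include h

lemma a_pos : 0 < a := by linarith [h.a_ge]

lemma ν_pos : 0 < ν := by linarith [h.ν_ge]

lemma t_pos : 0 < t := by
  have := h.a_pos
  have := h.ν_pos
  rw [h.t_eq]; positivity

lemma t_mul_ν : t * ν = a + 1 / (2 * ν) := by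
  have := h.ν_pos
  rw [h.t_eq]; field_simp

lemma a_le_t_mul_ν : a ≤ t * ν := by
  have := h.ν_pos
  rw [h.t_mul_ν]
  have : 0 ≤ 1 / (2 * ν) := by positivity
  linarith

lemma a_div_ν_le : a / ν ≤ t := (div_le_iff₀ h.ν_pos).2 h.a_le_t_mul_ν

lemma inv_ν_le : 1 / ν ≤ t := by
  refine le_trans ?_ h.a_div_ν_le
  have := h.ν_pos
  have := h.a_ge
  gcongr; linarith

/-- Compared with `r_mul_sinh`, this shows that `a` solves the critical point equation `r sinh a = a
/ t` up to a bounded error, although both sides are of size `ν`. -/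
lemma a_div_t : a / t = ν - 1 / (2 * (t * ν)) := by
  have := h.t_pos
  have := h.ν_pos
  have h1 : a = t * ν - 1 / (2 * ν) := by linarith [h.t_mul_ν]
  rw [h1]; field_simp

lemma correction_le : 1 / (2 * (t * ν)) ≤ 1 / 20 := by
  have := h.a_le_t_mul_ν
  have := h.a_ge
  apply one_div_le_one_div_of_le <;> linarith

lemma correction_nonneg : 0 ≤ 1 / (2 * (t * ν)) := by
  have := h.t_pos
  have := h.ν_pos
  positivity

lemma exp_a : rexp a = 2 * ν / r := by
  have := h.r_pos
  rw [h.ν_eq]; field_simp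

lemma r_mul_cosh : r * Real.cosh a = ν + r ^ 2 / (4 * ν) := by
  have := h.r_pos
  have := h.ν_pos
  rw [Real.cosh_eq, Real.exp_neg, h.exp_a]
  field_simp; ring

lemma r_mul_sinh : r * Real.sinh a = ν - r ^ 2 / (4 * ν) := by
  have := h.r_pos
  have := h.ν_pos
  rw [Real.sinh_eq, Real.exp_neg, h.exp_a]
  field_simp; ring

lemma quotient_nonneg : 0 ≤ r ^ 2 / (4 * ν) := by
  have := h.ν_pos
  positivity

lemma one_div_t_le : 1 / t ≤ ν / 10 := by
  rw [div_le_div_iff₀ h.t_pos (by norm_num)]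
  linarith [h.a_le_t_mul_ν, h.a_ge]

/-- The exponent of the integrand at the base point of the contour. -/
lemma exponent_eq : r * Real.cosh a - a ^ 2 / (2 * t) =
    ν - t * ν ^ 2 / 2 + 1 / 2 + (r ^ 2 / (4 * ν) - 1 / (8 * t * ν ^ 2)) := by
  have := h.t_pos
  have := h.ν_pos
  have h1 : a = t * ν - 1 / (2 * ν) := by linarith [h.t_mul_ν]
  rw [h.r_mul_cosh, h1]
  field_simp; ring

end SaddleData

/-! ### Saddle point estimate of the contour integral -/

/-- The exponent of the Hartman-Watson integrand on the vertical segment, relative to its value at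
the base point. -/
noncomputable def verticalExponent (r a t y : ℝ) : ℂ :=
  ((r * Real.cosh a * (Real.cos y - 1) + y ^ 2 / (2 * t) : ℝ) : ℂ) +
    ((r * Real.sinh a * Real.sin y - a / t * y : ℝ) : ℂ) * Complex.I

lemma hartmanWatsonKernel_vertical {t : ℝ} (ht : 0 < t) (r a y : ℝ) :
    hartmanWatsonKernel r t (a + y * Complex.I) =
      ((rexp (r * Real.cosh a - a ^ 2 / (2 * t)) : ℝ) : ℂ) *
        ((a + y * Complex.I) * Complex.exp (verticalExponent r a t y)) := by
  have ht' : (t : ℂ) ≠ 0 := by exact_mod_cast ht.ne'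
  rw [hartmanWatsonKernel, mul_assoc, ← Complex.exp_add, mul_left_comm, Complex.ofReal_exp,
    ← Complex.exp_add]
  congr 2
  rw [Complex.cosh_add, Complex.cosh_mul_I, Complex.sinh_mul_I, verticalExponent]
  push_cast
  field_simp
  linear_combination (-(y : ℂ) ^ 2) * Complex.I_sq

namespace SaddleData
variable {r a ν t : ℝ} (h : SaddleData r a ν t)
include h

/-- For `|y| ≤ π`, `cos y - 1 ≤ -2y²/π² ≤ -y²/5`, which yields decay `ν y²/5`. The growth `y²/(2t)`
takes back at most `ν y²/20`, because `a ≥ 10` forces `1/t ≤ ν/10`. -/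
lemma verticalExponent_re_le {y : ℝ} (hy : |y| ≤ π) :
    (verticalExponent r a t y).re ≤ -(ν / 10 * y ^ 2) := by
  have h1 := Real.cos_le_one_sub_mul_cos_sq hy
  have h2 : (1 / 5 : ℝ) ≤ 2 / π ^ 2 := by
    rw [div_le_div_iff₀ (by norm_num) (by positivity)]
    nlinarith [pi_lt_d2, pi_pos]
  have hν := h.ν_pos
  have hc : ν ≤ r * Real.cosh a := by rw [h.r_mul_cosh]; linarith [h.quotient_nonneg]
  have h3 : y ^ 2 / (2 * t) ≤ ν / 20 * y ^ 2 := by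
    have := mul_le_mul_of_nonneg_right h.one_div_t_le (sq_nonneg y)
    have e : y ^ 2 / (2 * t) = 1 / t * y ^ 2 / 2 := by
      have := h.t_pos
      field_simp
    rw [e]; linarith
  have h4 : Real.cos y - 1 ≤ -(1 / 5 * y ^ 2) := by
    have := mul_le_mul_of_nonneg_right h2 (sq_nonneg y)
    linarith
  have h5 : r * Real.cosh a * (Real.cos y - 1) ≤ ν * -(1 / 5 * y ^ 2) := by
    have h6 : r * Real.cosh a * (Real.cos y - 1) ≤ ν * (Real.cos y - 1) :=
      mul_le_mul_of_nonpos_right hc (by linarith [Real.cos_le_one y])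
    exact h6.trans (by gcongr)
  have : (verticalExponent r a t y).re =
      r * Real.cosh a * (Real.cos y - 1) + y ^ 2 / (2 * t) := by
    simp only [verticalExponent, Complex.add_re, Complex.ofReal_re, Complex.re_ofReal_mul,
      Complex.I_re, mul_zero, add_zero]
  rw [this]
  have : 0 ≤ ν * y ^ 2 := by positivity
  linarith

lemma gaussianExponent_le (y : ℝ) : -((a - 1) / (2 * t)) * y ^ 2 ≤ -(ν / 10 * y ^ 2) := by
  have h1 : ν / 10 ≤ (a - 1) / (2 * t) := by
    have e : (a - 1) / (2 * t) = (a / t - 1 / t) / 2 := by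
      have := h.t_pos
      field_simp
    rw [e, h.a_div_t]
    linarith [h.one_div_t_le, h.correction_le, h.ν_ge]
  nlinarith [sq_nonneg y]

/-- The Taylor remainders of cosine and sine give the cubic term, with coefficients `4` and `2`. The
bounded discrepancies between `r cosh a`, `r sinh a` and `a/t` give the linear one, with `2` and
`1`. -/
lemma norm_verticalExponent_sub_le {y : ℝ} (hy : |y| ≤ π) :
    ‖verticalExponent r a t y - ((-((a - 1) / (2 * t)) * y ^ 2 : ℝ) : ℂ)‖ ≤
      (6 * (ν * y ^ 2) + 3) * |y| := by
  have hν := h.ν_ge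
  have ht := h.t_pos
  have hsq := h.quotient_le
  have hsq0 := h.quotient_nonneg
  have hc1 := h.correction_le
  have hc0 := h.correction_nonneg
  have e : verticalExponent r a t y - ((-((a - 1) / (2 * t)) * y ^ 2 : ℝ) : ℂ) =
      ((r * Real.cosh a * (Real.cos y - 1 + y ^ 2 / 2) +
        (a / t - r * Real.cosh a) * (y ^ 2 / 2) : ℝ) : ℂ) +
      ((r * Real.sinh a * (Real.sin y - y) + (r * Real.sinh a - a / t) * y : ℝ) : ℂ) *
        Complex.I := by
    have ht' : (t : ℂ) ≠ 0 := by exact_mod_cast ht.ne'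
    rw [verticalExponent]
    push_cast
    field_simp
    ring
  have hy0 := abs_nonneg y
  have h3 : |y| ^ 3 = y ^ 2 * |y| := by rw [← sq_abs y]; ring
  have b1 : |r * Real.cosh a * (Real.cos y - 1 + y ^ 2 / 2) +
      (a / t - r * Real.cosh a) * (y ^ 2 / 2)| ≤ 4 * (ν * y ^ 2) * |y| + 2 * |y| := by
    refine (abs_add_le _ _).trans (add_le_add ?_ ?_)
    · rw [abs_mul, h.r_mul_cosh, abs_of_nonneg (by linarith)]
      calc _ ≤ 2 * ν * (2 * |y| ^ 3) := by
            gcongr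
            · linarith
            · exact abs_cos_sub_one_add_sq_le y
        _ = _ := by rw [h3]; ring
    · rw [abs_mul, h.r_mul_cosh, h.a_div_t, abs_of_nonneg (show 0 ≤ y ^ 2 / 2 by positivity),
        ← sq_abs y]
      have : |ν - 1 / (2 * (t * ν)) - (ν + r ^ 2 / (4 * ν))| ≤ 1 := by
        rw [abs_le]; constructor <;> linarith
      calc _ ≤ 1 * (|y| ^ 2 / 2) := by gcongr
        _ ≤ 2 * |y| := by nlinarith [pi_lt_four]
  have b2 : |r * Real.sinh a * (Real.sin y - y) + (r * Real.sinh a - a / t) * y| ≤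
      2 * (ν * y ^ 2) * |y| + |y| := by
    refine (abs_add_le _ _).trans (add_le_add ?_ ?_)
    · rw [abs_mul, h.r_mul_sinh, abs_of_nonneg (by linarith)]
      calc _ ≤ ν * (2 * |y| ^ 3) := by
            gcongr
            · linarith
            · exact abs_sin_sub_self_le y
        _ = _ := by rw [h3]; ring
    · rw [abs_mul, h.r_mul_sinh, h.a_div_t]
      have : |ν - r ^ 2 / (4 * ν) - (ν - 1 / (2 * (t * ν)))| ≤ 1 := by
        rw [abs_le]; constructor <;> linarith
      exact mul_le_of_le_one_left hy0 this
  rw [e]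
  refine (norm_add_le _ _).trans ?_
  rw [norm_mul, Complex.norm_I, mul_one, Complex.norm_real, Complex.norm_real, Real.norm_eq_abs,
    Real.norm_eq_abs]
  linarith

lemma norm_vertical_sub_gaussian_le (y : ℝ) :
    ‖(Icc (-π) π).indicator
        (fun y : ℝ => (a + y * Complex.I) * Complex.exp (verticalExponent r a t y)) y -
      ((a * rexp (-((a - 1) / (2 * t)) * y ^ 2) : ℝ) : ℂ)‖ ≤
      124 * a * (|y| * rexp (-(ν / 20) * y ^ 2)) := by
  have ha := h.a_ge
  have hν := h.ν_pos
  have hy0 := abs_nonneg y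
  have hB := h.gaussianExponent_le y
  have hhalf : -(ν / 10 * y ^ 2) ≤ -(ν / 20) * y ^ 2 := by nlinarith [mul_nonneg hν.le (sq_nonneg y)]
  by_cases hy : y ∈ Icc (-π) π
  · rw [indicator_of_mem hy]
    have hy' : |y| ≤ π := abs_le.2 hy
    have hA := h.verticalExponent_re_le hy'
    set A := verticalExponent r a t y
    set B : ℂ := ((-((a - 1) / (2 * t)) * y ^ 2 : ℝ) : ℂ) with hBdef
    have hd : ‖Complex.exp A - Complex.exp B‖ ≤ 123 * rexp (-(ν / 20) * y ^ 2) * |y| := by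
      calc _ ≤ rexp (-(ν / 10 * y ^ 2)) * ‖A - B‖ := norm_cexp_sub_cexp_le hA
            (by rw [hBdef, Complex.ofReal_re]; exact hB)
        _ ≤ rexp (-(ν / 10 * y ^ 2)) * ((6 * (ν * y ^ 2) + 3) * |y|) := by
            gcongr; exact h.norm_verticalExponent_sub_le hy'
        _ = ((6 * (ν * y ^ 2) + 3) * rexp (-(ν / 10 * y ^ 2))) * |y| := by ring
        _ ≤ _ := mul_le_mul_of_nonneg_right (mul_sq_add_mul_exp_le y) hy0
    -- Replacing the factor `a + iy` by `a` costs `|y|`, at most `a |y|`; with the `123` from the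
    -- exponentials this makes `124`.
    have e : (a + y * Complex.I) * Complex.exp A - ((a * rexp (-((a - 1) / (2 * t)) * y ^ 2) : ℝ) : ℂ)
        = y * Complex.I * Complex.exp A + a * (Complex.exp A - Complex.exp B) := by
      rw [Complex.ofReal_mul, Complex.ofReal_exp, ← hBdef]; ring
    have hAn : ‖Complex.exp A‖ ≤ rexp (-(ν / 20) * y ^ 2) := by
      rw [Complex.norm_exp]
      exact Real.exp_le_exp.2 (hA.trans hhalf)
    rw [e]
    refine (norm_add_le _ _).trans ?_
    rw [norm_mul, norm_mul, norm_mul, Complex.norm_I, Complex.norm_real, Complex.norm_real,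
      Real.norm_eq_abs, Real.norm_of_nonneg (by linarith), mul_one]
    calc _ ≤ |y| * rexp (-(ν / 20) * y ^ 2) + a * (123 * rexp (-(ν / 20) * y ^ 2) * |y|) := by
          gcongr
      _ ≤ _ := by
          have : 0 ≤ |y| * rexp (-(ν / 20) * y ^ 2) := by positivity
          nlinarith
  · rw [indicator_of_notMem hy, zero_sub, norm_neg, Complex.norm_real,
      Real.norm_of_nonneg (by positivity)]
    -- Beyond the segment only the Gaussian tail is left, and `|y| ≥ 1` supplies the factor `|y|` of
    -- the bound.
    have hy1 : 1 ≤ |y| := by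
      by_contra hcon
      exact hy (abs_le.1 (by linarith [pi_gt_three]))
    have h1 : rexp (-((a - 1) / (2 * t)) * y ^ 2) ≤ |y| * rexp (-(ν / 20) * y ^ 2) :=
      (Real.exp_le_exp.2 (hB.trans hhalf)).trans (le_mul_of_one_le_left (Real.exp_pos _).le hy1)
    have h2 : 0 ≤ |y| * rexp (-(ν / 20) * y ^ 2) := by positivity
    nlinarith

lemma norm_integral_vertical_sub_le :
    ‖(∫ y in (-π)..π, (a + y * Complex.I) * Complex.exp (verticalExponent r a t y)) -
      ((a * √(2 * π * t / (a - 1)) : ℝ) : ℂ)‖ ≤ 2480 * t := by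
  have hp := pi_pos
  have ht := h.t_pos
  have ha := h.a_ge
  have hν := h.ν_pos
  have e1 : ∫ y in (-π)..π, (a + y * Complex.I) * Complex.exp (verticalExponent r a t y) =
      ∫ y, (Icc (-π) π).indicator
        (fun y : ℝ => (a + y * Complex.I) * Complex.exp (verticalExponent r a t y)) y := by
    rw [intervalIntegral.integral_of_le (by linarith), ← integral_Icc_eq_integral_Ioc,
      integral_indicator measurableSet_Icc]
  have hb : 0 < (a - 1) / (2 * t) := div_pos (by linarith) (by positivity)
  have e2 : ((a * √(2 * π * t / (a - 1)) : ℝ) : ℂ) =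
      ∫ y : ℝ, ((a * rexp (-((a - 1) / (2 * t)) * y ^ 2) : ℝ) : ℂ) := by
    rw [integral_complex_ofReal, integral_const_mul, integral_gaussian]
    congr 3
    have : a - 1 ≠ 0 := by linarith
    field_simp
  have hc : Continuous fun y : ℝ => (a + y * Complex.I) * Complex.exp (verticalExponent r a t y) := by
    unfold verticalExponent; fun_prop
  have i1 : Integrable ((Icc (-π) π).indicator
      (fun y : ℝ => (a + y * Complex.I) * Complex.exp (verticalExponent r a t y))) :=
    (integrable_indicator_iff measurableSet_Icc).2 hc.integrableOn_Icc
  have i2 : Integrable fun y : ℝ => ((a * rexp (-((a - 1) / (2 * t)) * y ^ 2) : ℝ) : ℂ) :=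
    ((integrable_exp_neg_mul_sq hb).const_mul a).ofReal
  have hβ : 0 < ν / 20 := by positivity
  rw [e1, e2, ← integral_sub i1 i2]
  refine (norm_integral_le_of_norm_le ((integrable_abs_mul_exp_neg_mul_sq hβ).const_mul (124 * a))
    (ae_of_all _ h.norm_vertical_sub_gaussian_le)).trans ?_
  rw [integral_const_mul, integral_abs_mul_exp_neg_mul_sq hβ]
  calc 124 * a * (1 / (ν / 20)) = 2480 * (a / ν) := by field_simp; norm_num
    _ ≤ _ := by gcongr; exact h.a_div_ν_le

lemma norm_hartmanWatsonKernel_horizontal_le {x y : ℝ} (hx : a < x) (hy : y ^ 2 = π ^ 2)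
    (hcos : Real.cos y = -1) :
    ‖hartmanWatsonKernel r t (x + y * Complex.I)‖ ≤
      2 * rexp (r * Real.cosh a - a ^ 2 / (2 * t)) * rexp (a ^ 2 / (2 * t)) *
        (x * rexp (-(1 / (2 * t)) * x ^ 2)) := by
  have ht := h.t_pos
  have ha := h.a_ge
  have hν := h.ν_pos
  have hr := h.r_pos
  have hyp : |y| ≤ 4 := by
    rw [← abs_of_pos pi_pos] at *
    rw [(sq_eq_sq_iff_abs_eq_abs _ _).1 hy, abs_abs]
    rw [abs_of_pos pi_pos]
    exact pi_lt_four.le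
  rw [hartmanWatsonKernel_vertical ht, norm_mul, norm_mul, Complex.norm_real,
    Real.norm_of_nonneg (Real.exp_pos _).le, Complex.norm_exp]
  have hre : (verticalExponent r x t y).re = -2 * (r * Real.cosh x) + π ^ 2 / (2 * t) := by
    simp only [verticalExponent, Complex.add_re, Complex.ofReal_re, Complex.re_ofReal_mul,
      Complex.I_re, mul_zero, add_zero, hcos, hy]
    ring
  have h1 : ‖(x : ℂ) + y * Complex.I‖ ≤ 2 * x := by
    refine (norm_add_le _ _).trans ?_
    rw [norm_mul, Complex.norm_I, Complex.norm_real, Complex.norm_real, Real.norm_eq_abs,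
      Real.norm_eq_abs, abs_of_pos (by linarith)]
    linarith
  have h2 : ν ≤ r * Real.cosh a := by rw [h.r_mul_cosh]; linarith [h.quotient_nonneg]
  have h3 : r * Real.cosh a ≤ r * Real.cosh x := by
    gcongr
    exact Real.cosh_le_cosh.2 (by rw [abs_of_pos h.a_pos, abs_of_pos (by linarith)]; exact hx.le)
  -- On the rays `cos y = -1` reverses the sign of `r cosh x`. This term outweighs the growth
  -- `π²/(2t)` caused by the imaginary part, so only `exp(-x²/(2t))` has to be integrated.
  have h4 : π ^ 2 / (2 * t) ≤ ν := by
    have e : π ^ 2 / (2 * t) = π ^ 2 / 2 * (1 / t) := by field_simp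
    have : π ^ 2 / 2 * (1 / t) ≤ 10 * (ν / 10) :=
      mul_le_mul (by nlinarith [pi_lt_four, pi_pos]) h.one_div_t_le (by positivity) (by norm_num)
    linarith
  rw [hre]
  have hx0 : 0 < x := by linarith
  calc _ ≤ rexp (r * Real.cosh x - x ^ 2 / (2 * t)) *
        (2 * x * rexp (-2 * (r * Real.cosh x) + π ^ 2 / (2 * t))) := by gcongr
    _ = 2 * x * rexp (-(r * Real.cosh x) + π ^ 2 / (2 * t) - x ^ 2 / (2 * t)) := by
        rw [mul_left_comm, ← Real.exp_add]; ring_nf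
    _ ≤ 2 * x * rexp (r * Real.cosh a - x ^ 2 / (2 * t)) := by
        gcongr; linarith
    _ = 2 * x * rexp ((r * Real.cosh a - a ^ 2 / (2 * t)) + a ^ 2 / (2 * t) +
          -(1 / (2 * t)) * x ^ 2) := by ring_nf
    _ = _ := by rw [Real.exp_add, Real.exp_add]; ring

lemma norm_integral_horizontal_le :
    ‖∫ x in Ioi a, (hartmanWatsonKernel r t (x - π * Complex.I) -
      hartmanWatsonKernel r t (x + π * Complex.I))‖ ≤
      4 * t * rexp (r * Real.cosh a - a ^ 2 / (2 * t)) := by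
  have ht := h.t_pos
  have hβ : 0 < 1 / (2 * t) := by positivity
  set M := rexp (r * Real.cosh a - a ^ 2 / (2 * t))
  refine (norm_integral_le_of_norm_le (g := fun x => 4 * M * rexp (a ^ 2 / (2 * t)) *
    (x * rexp (-(1 / (2 * t)) * x ^ 2)))
    ((integrable_mul_exp_neg_mul_sq hβ).integrableOn.const_mul _) ?_).trans ?_
  · filter_upwards [ae_restrict_mem measurableSet_Ioi] with x hx
    have b1 := h.norm_hartmanWatsonKernel_horizontal_le hx (y := -π) (by ring) (by simp)
    have b2 := h.norm_hartmanWatsonKernel_horizontal_le hx (y := π) rfl (by simp)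
    have e : (x : ℂ) + ((-π : ℝ) : ℂ) * Complex.I = x - π * Complex.I := by push_cast; ring
    rw [e] at b1
    refine (norm_sub_le _ _).trans ((add_le_add b1 b2).trans (le_of_eq ?_))
    ring
  · rw [integral_const_mul, integral_Ioi_mul_exp_neg_mul_sq hβ]
    have e : rexp (a ^ 2 / (2 * t)) * rexp (-(1 / (2 * t)) * a ^ 2) = 1 := by
      rw [← Real.exp_add, Real.exp_eq_one_iff]; ring
    refine le_of_eq ?_
    calc _ = 4 * M * (rexp (a ^ 2 / (2 * t)) * rexp (-(1 / (2 * t)) * a ^ 2)) /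
          (2 * (1 / (2 * t))) := by ring
      _ = _ := by rw [e]; field_simp

/-- The saddle point approximation of the contour integral. -/
lemma abs_hankelIntegral_sub_le :
    |2 * π * (hankelIntegral a (hartmanWatsonKernel r t)).re *
        rexp (-(r * Real.cosh a - a ^ 2 / (2 * t))) - a * √(2 * π * t / (a - 1))| ≤ 2484 * t := by
  have ht := h.t_pos
  have hpa : π ≤ a := by linarith [pi_lt_four, h.a_ge]
  set E := r * Real.cosh a - a ^ 2 / (2 * t) with hE
  have hpi : (π : ℂ) ≠ 0 := by exact_mod_cast pi_ne_zero
  have hEE : rexp E * rexp (-E) = 1 := by rw [← Real.exp_add]; simp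
  have hEC : ((rexp E : ℝ) : ℂ) * ((rexp (-E) : ℝ) : ℂ) = 1 := by
    rw [← Complex.ofReal_mul, hEE]; simp
  have key : 2 * π * hankelIntegral a (hartmanWatsonKernel r t) * ((rexp (-E) : ℝ) : ℂ) -
      ((a * √(2 * π * t / (a - 1)) : ℝ) : ℂ) =
      ((∫ y in (-π)..π, (a + y * Complex.I) * Complex.exp (verticalExponent r a t y)) -
        ((a * √(2 * π * t / (a - 1)) : ℝ) : ℂ)) +
      Complex.I * (∫ x in Ioi a, (hartmanWatsonKernel r t (x - π * Complex.I) -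
        hartmanWatsonKernel r t (x + π * Complex.I))) * ((rexp (-E) : ℝ) : ℂ) := by
    rw [hankelIntegral_eq_pieces (integrable_hartmanWatsonKernel h.r_pos hpa ht)]
    simp only [hartmanWatsonKernel_vertical ht r a, ← hE]
    rw [intervalIntegral.integral_const_mul]
    generalize (∫ y in (-π)..π, (a + y * Complex.I) *
      Complex.exp (verticalExponent r a t y)) = V
    field_simp
    linear_combination V * hEC
  have hnorm : ‖2 * π * hankelIntegral a (hartmanWatsonKernel r t) * ((rexp (-E) : ℝ) : ℂ) -
      ((a * √(2 * π * t / (a - 1)) : ℝ) : ℂ)‖ ≤ 2484 * t := by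
    rw [key]
    refine (norm_add_le _ _).trans ?_
    rw [norm_mul, norm_mul, Complex.norm_I, one_mul, Complex.norm_real,
      Real.norm_of_nonneg (Real.exp_pos _).le]
    have h1 := h.norm_integral_vertical_sub_le
    have h2 := mul_le_mul_of_nonneg_right h.norm_integral_horizontal_le (Real.exp_pos (-E)).le
    rw [← hE, mul_assoc (4 * t), hEE, mul_one] at h2
    linarith
  rw [← ofReal_hankelIntegral_re] at hnorm
  rw [← Real.norm_eq_abs, ← Complex.norm_real]
  refine le_trans (le_of_eq ?_) hnorm
  push_cast
  ring_nf

end SaddleData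

/-! ### Relative error and comparison of prefactors -/

namespace SaddleData
variable {r a ν t : ℝ} (h : SaddleData r a ν t)
include h

lemma log_eq : Real.log (2 * ν / r) = a := by rw [← h.exp_a, Real.log_exp]

lemma sqrt_quotient_eq : √(ν ^ 2 / 2 / (Real.log (ν ^ 2 / 2) - 2 - 2 * rhoParam r)) =
    ν / (2 * √(a - 1)) := by
  have h1 := half_log_sub_rhoParam h.r_pos h.ν_pos rfl
  rw [h.log_eq] at h1
  have h2 : 0 < a - 1 := by linarith [h.a_ge]
  rw [show Real.log (ν ^ 2 / 2) - 2 - 2 * rhoParam r = 2 * (a - 1) by linarith,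
    show ν ^ 2 / 2 / (2 * (a - 1)) = (ν / 2) ^ 2 / (a - 1) by field_simp,
    Real.sqrt_div (by positivity), Real.sqrt_sq (by have := h.ν_pos; positivity)]
  field_simp

lemma abs_exp_correction_le (ht1 : t ≤ 1) :
    |r ^ 2 / (4 * ν) - 1 / (8 * t * ν ^ 2)| ≤ 1 ∧ |r ^ 2 / (4 * ν) - 1 / (8 * t * ν ^ 2)| ≤ (r ^ 2 / 4 + 1) * √t := by
  have ht := h.t_pos
  have hν := h.ν_pos
  have htt : t ≤ √t := by
    have := Real.sq_sqrt ht.le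
    nlinarith [Real.sqrt_le_one.2 ht1, Real.sqrt_pos.2 ht]
  have hc := h.correction_le
  have hc0 := h.correction_nonneg
  have h0 : 0 ≤ 1 / ν := by positivity
  -- One factor is at most `1/20`, and the other, `1/ν`, is at most `t ≤ √t`.
  have hηe : 1 / (8 * t * ν ^ 2) = 1 / (2 * (t * ν)) * (1 / ν) / 4 := by field_simp; norm_num
  constructor
  · have h1 := h.quotient_le
    have h2 := h.quotient_nonneg
    have h3 : 1 / ν ≤ 1 := by rw [div_le_one hν]; exact h.ν_ge
    rw [hηe, abs_le]
    constructor <;> nlinarith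
  · have h1 : r ^ 2 / (4 * ν) = r ^ 2 / 4 * (1 / ν) := by field_simp
    have h2 : 1 / ν ≤ √t := h.inv_ν_le.trans htt
    have h3 : r ^ 2 / 4 * (1 / ν) ≤ r ^ 2 / 4 * √t := by gcongr
    have h4 : 0 ≤ r ^ 2 / 4 * (1 / ν) := by positivity
    rw [hηe, h1, abs_le]
    constructor <;> nlinarith

/-- Three sources of error: `p` is the contour error over the main term, `q` comes from replacing
`a` by `tν` in the prefactor, and `η` is the remainder of the exponent. Each is `O(√t)`; the
constant is `3·2484 + 3 + 2(r²/4 + 1)`. -/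
lemma abs_relative_error_le (ht1 : t ≤ 1) {R p q η : ℝ} (hRle : |R| ≤ 2484 * t)
    (hp : p = R * √(a - 1) / (√(2 * π) * (t * √t) * ν)) (hq : q = a / (t * ν))
    (hη : η = r ^ 2 / (4 * ν) - 1 / (8 * t * ν ^ 2)) :
    |rexp η * (q + p) - 1| ≤ (7457 + r ^ 2 / 2) * √t := by
  have ht := h.t_pos
  have hν := h.ν_pos
  have ha := h.a_ge
  obtain ⟨hη1, hη2⟩ := h.abs_exp_correction_le ht1
  rw [← hη] at hη1 hη2
  have hst : 0 < √t := Real.sqrt_pos.2 ht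
  have hsq : √t ^ 2 = t := Real.sq_sqrt ht.le
  have ha1 : 0 < √(a - 1) := Real.sqrt_pos.2 (by linarith)
  have htt : t ≤ √t := by nlinarith [Real.sqrt_le_one.2 ht1]
  have hp1 : |p| ≤ 2484 * √t := by
    rw [hp, abs_div, abs_mul, abs_of_pos ha1,
      abs_of_pos (show 0 < √(2 * π) * (t * √t) * ν by positivity), div_le_iff₀ (by positivity)]
    have h1 : √(a - 1) ≤ a := by
      rw [Real.sqrt_le_left (by linarith)]; nlinarith
    have h2 : 1 ≤ √(2 * π) := by
      rw [Real.one_le_sqrt]; linarith [pi_gt_three]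
    calc |R| * √(a - 1) ≤ 2484 * t * (t * ν) := by
          gcongr; exact h1.trans h.a_le_t_mul_ν
      _ = 2484 * √t * (1 * (t * √t) * ν) := by
          linear_combination (-(2484 * t * ν)) * hsq
      _ ≤ _ := by gcongr
  have hc := h.correction_le
  have hc0 := h.correction_nonneg
  have hq1 : |q - 1| ≤ √t := by
    have e : q - 1 = -(1 / (2 * (t * ν)) * (1 / ν)) := by
      have : a = t * ν - 1 / (2 * ν) := by linarith [h.t_mul_ν]
      rw [hq, this]; field_simp; ring
    rw [e, abs_neg, abs_of_nonneg (by positivity)]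
    have := h.inv_ν_le
    have h0 : 0 ≤ 1 / ν := by positivity
    nlinarith
  have he1 : rexp η ≤ 3 :=
    (Real.exp_le_exp.2 ((le_abs_self η).trans hη1)).trans (by linarith [Real.exp_one_lt_d9])
  have he2 : |rexp η - 1| ≤ 2 * |η| := Real.abs_exp_sub_one_le hη1
  have e : rexp η * (q + p) - 1 = rexp η * p + rexp η * (q - 1) + (rexp η - 1) := by ring
  rw [e]
  calc _ ≤ |rexp η * p| + |rexp η * (q - 1)| + |rexp η - 1| :=
        (abs_add_le _ _).trans (by gcongr; exact abs_add_le _ _)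
    _ ≤ 3 * (2484 * √t) + 3 * √t + 2 * ((r ^ 2 / 4 + 1) * √t) := by
        rw [abs_mul, abs_mul, abs_of_pos (Real.exp_pos η)]
        gcongr
        linarith
    _ = _ := by ring

/-- Multiplicative form of the saddle point approximation, with explicit relative error. -/
lemma exists_relative_error (ht1 : t ≤ 1) : ∃ ε : ℝ, |ε| ≤ (7457 + r ^ 2 / 2) * √t ∧
    hartmanWatsonDensity r t = √(rexp 1) / (π * besselI0 r) * (ν / (2 * √(a - 1))) *
      rexp (-t * (ν ^ 2 / 2) + ν) * (1 + ε) := by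
  have ht := h.t_pos
  have hν := h.ν_pos
  have ha := h.a_ge
  have hI := besselI0_pos r
  have hp := pi_pos
  have hpa : π ≤ a := by linarith [pi_lt_four]
  set E := r * Real.cosh a - a ^ 2 / (2 * t) with hE
  set η := r ^ 2 / (4 * ν) - 1 / (8 * t * ν ^ 2) with hη
  set H := (hankelIntegral a (hartmanWatsonKernel r t)).re with hH
  set S := a * √(2 * π * t / (a - 1)) with hS
  set R := 2 * π * H * rexp (-E) - S with hR
  have hRle : |R| ≤ 2484 * t := h.abs_hankelIntegral_sub_le
  set q := a / (t * ν) with hq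
  set p := R * √(a - 1) / (√(2 * π) * (t * √t) * ν) with hpdef
  have ha1 : 0 < √(a - 1) := Real.sqrt_pos.2 (by linarith)
  have hS' : S * √(a - 1) = a * (√(2 * π) * √t) := by
    rw [hS, Real.sqrt_div (by positivity), Real.sqrt_mul (by positivity)]
    field_simp
  refine ⟨rexp η * (q + p) - 1, h.abs_relative_error_le ht1 hRle hpdef hq hη, ?_⟩
  have hEe : rexp E = rexp (-t * (ν ^ 2 / 2) + ν) * rexp (1 / 2) * rexp η := by
    rw [← Real.exp_add, ← Real.exp_add, hE, h.exponent_eq]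
    congr 1; ring
  have hHe : H = (S + R) * rexp E / (2 * π) := by
    have : rexp (-E) * rexp E = 1 := by rw [← Real.exp_add]; simp
    rw [hR]
    field_simp
    linear_combination (-(2 * π * H)) * this
  have hqp : q + p = (S + R) * √(a - 1) / (√(2 * π) * (t * √t) * ν) := by
    rw [hq, hpdef, add_mul, hS', add_div]
    congr 1
    field_simp
  rw [hartmanWatsonDensity_eq h.r_pos hpa ht, ← hH, hHe, hEe, ← Real.exp_half,
    add_sub_cancel (1 : ℝ),
    hqp]
  generalize S + R = W
  generalize rexp (-t * (ν ^ 2 / 2) + ν) = X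
  generalize rexp (1 / 2) = Y
  generalize rexp η = Z
  field_simp

/-- Comparison of the two prefactors. -/
lemma abs_prefactor_ratio_sub_one_le {L c : ℝ} (hL : L = Real.log (1 / t))
    (hc : c = 1 / 2 + |Real.log (r / 2)|) (hm : Real.log (t * ν) + c ≤ t * ν / 2)
    (hL1 : 1 ≤ Real.log L) (hLc : c ≤ Real.log L) (hL2 : 3 * Real.log L + 2 ≤ L / 2) :
    |t * ν / (√(a - 1) * √L) - 1| ≤ 16 * (Real.log L / L) := by
  have ht := h.t_pos
  have hν := h.ν_pos
  have ha := h.a_ge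
  have hr := h.r_pos
  have hLpos : 0 < L := by linarith
  set m := t * ν with hmdef
  have hma : a ≤ m := h.a_le_t_mul_ν
  have hm0 : 0 < m := by linarith
  have hma' : m ≤ a + 1 / 2 := by
    rw [hmdef, h.t_mul_ν]
    gcongr
    · linarith [h.ν_ge]
  -- Take logarithms in `1/t = ν/m` with `ν = (r/2) exp a`. Since `m ≤ a + 1/2`, it follows that `L
  -- ≥ m - c - log m ≥ m/2`; the summand `1/2` in `c` serves this bound.
  have hLm : L = a + Real.log (r / 2) - Real.log m := by
    rw [hL, show 1 / t = ν / m by rw [hmdef]; field_simp, Real.log_div hν.ne' hm0.ne']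
    nth_rewrite 1 [h.ν_eq]
    rw [Real.log_mul (by positivity) (Real.exp_pos a).ne', Real.log_exp]
    ring
  have hlr := abs_le.1 (le_refl |Real.log (r / 2)|)
  have hlm0 : 0 ≤ Real.log m := Real.log_nonneg (by linarith)
  have hm2 : m ≤ 2 * L := by linarith
  have hlm : Real.log m ≤ 2 * Real.log L := by
    have h1 : Real.log m ≤ Real.log (2 * L) := Real.log_le_log hm0 hm2
    rw [Real.log_mul two_ne_zero hLpos.ne'] at h1
    linarith [Real.log_two_lt_d9]
  have hdiff : |m - L| ≤ 3 * Real.log L := by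
    rw [abs_le]; constructor <;> linarith
  have hd := abs_le.1 hdiff
  have ha1 : L / 2 ≤ a - 1 := by linarith
  have ha1p : 0 < a - 1 := by linarith
  set κ := m / (√(a - 1) * √L) with hκ
  have hκ0 : 0 ≤ κ := by positivity
  have hκ2 : κ ^ 2 = m ^ 2 / ((a - 1) * L) := by
    rw [hκ, div_pow, mul_pow (√(a - 1)), Real.sq_sqrt ha1p.le, Real.sq_sqrt hLpos.le]
  -- Squaring removes the roots, and `κ + 1 ≥ 1` makes it harmless.
  have h1 : |κ - 1| ≤ |κ ^ 2 - 1| := by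
    rw [show κ ^ 2 - 1 = (κ - 1) * (κ + 1) by ring, abs_mul, abs_of_nonneg (by linarith : 0 ≤ κ + 1)]
    exact le_mul_of_one_le_right (abs_nonneg _) (by linarith)
  refine h1.trans ?_
  have hden : 0 < (a - 1) * L := by positivity
  have h2 : κ ^ 2 - 1 = (m * (m - L) + (m - a + 1) * L) / ((a - 1) * L) := by
    rw [hκ2, eq_div_iff hden.ne', sub_mul, div_mul_cancel₀ _ hden.ne']
    ring
  have h3 : |m * (m - L) + (m - a + 1) * L| ≤ 8 * L * Real.log L := by
    calc _ ≤ |m * (m - L)| + |(m - a + 1) * L| := abs_add_le _ _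
      _ = m * |m - L| + (m - a + 1) * L := by
          rw [abs_mul, abs_of_pos hm0, abs_of_nonneg (mul_nonneg (by linarith) hLpos.le)]
      _ ≤ 2 * L * (3 * Real.log L) + 2 * L := by
          gcongr
          linarith
      _ ≤ _ := by nlinarith
  rw [h2, abs_div, abs_of_pos hden, div_le_iff₀ hden]
  refine h3.trans ?_
  have h4 : 8 * L * Real.log L = 16 * (Real.log L / L) * (L / 2 * L) := by field_simp; norm_num
  rw [h4]
  gcongr

end SaddleData

/-! ### Assembly of the two asymptotic formulas -/

lemma eventually_saddleData {r : ℝ} (hr : 0 < r) (A : ℝ) :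
    ∀ᶠ t in 𝓝[>] (0 : ℝ), SaddleData r (Real.log (2 * √(2 * saddlePoint r t) / r))
      (√(2 * saddlePoint r t)) t ∧ A ≤ Real.log (2 * √(2 * saddlePoint r t) / r) := by
  have hν := tendsto_sqrt_two_mul_atTop.comp (tendsto_saddlePoint hr)
  have ha := (tendsto_log_two_mul_div_atTop hr).comp hν
  filter_upwards [hν.eventually_ge_atTop (max 1 (r ^ 2)), ha.eventually_ge_atTop (max 10 A),
    eventually_isGreatest_saddleSolutions hr 0] with t h1 h2 h3
  obtain ⟨hu, hut⟩ := h3.1.1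
  simp only [Function.comp] at h1 h2
  set u := saddlePoint r t
  set ν := √(2 * u) with hνdef
  have hν1 : 1 ≤ ν := (le_max_left _ _).trans h1
  have hν0 : 0 < ν := by linarith
  have hν2 : r ^ 2 ≤ ν := (le_max_right _ _).trans h1
  refine ⟨⟨hr, (le_max_left _ _).trans h2, hν1, ?_, ?_, ?_⟩, (le_max_right _ _).trans h2⟩
  · rw [Real.exp_log (by positivity)]; field_simp
  · rw [div_le_iff₀ (by positivity)]; linarith
  · have huν : u = ν ^ 2 / 2 := by rw [hνdef, Real.sq_sqrt (by positivity)]; ring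
    rw [← saddleTime_eq hr hν0 huν]
    exact hut

/-- Used to absorb the `O(√t)` error into the coarser one of the second formula; it is `log x ≤ x -
1` at `x = 1/√t`. -/
lemma sqrt_le_two_div_log {t : ℝ} (ht : 0 < t) (hL : 0 < Real.log (1 / t)) :
    √t ≤ 2 / Real.log (1 / t) := by
  rw [le_div_iff₀ hL]
  have hs : 0 < √t := Real.sqrt_pos.2 ht
  have h1 : Real.log (1 / t) = 2 * Real.log (√t)⁻¹ := by
    rw [one_div, Real.log_inv, Real.log_inv, Real.log_sqrt ht.le]; ring
  have h2 := Real.log_le_sub_one_of_pos (inv_pos.2 hs)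
  have h3 : √t * (√t)⁻¹ = 1 := mul_inv_cancel₀ hs.ne'
  rw [h1]
  nlinarith

theorem theorem1 (r : ℝ) (hr : 0 < r) :
    -- for all small `t > 0` the equation has a largest solution, and it is `u_0(t)`
    (∀ᶠ t in 𝓝[>] (0 : ℝ), IsGreatest (saddleSolutions r t) (saddlePoint r t)) ∧
    -- the Hartman-Watson density exists
    (∃ f : ℝ → ℝ, IsHartmanWatsonDensity r f) ∧
    -- and its behaviour as `t → 0+` is given by the fine and by the rough formula
    ∀ f : ℝ → ℝ, IsHartmanWatsonDensity r f →
      (∃ ε : ℝ → ℝ,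
        ε =O[𝓝[>] (0 : ℝ)] (fun t => √t * Real.log (1 / t) ^ 2) ∧
        ∀ᶠ t in 𝓝[>] (0 : ℝ),
          f t = √(Real.exp 1) / (π * besselI0 r)
            * √(saddlePoint r t / (Real.log (saddlePoint r t) - 2 - 2 * rhoParam r))
            * Real.exp (-t * saddlePoint r t + √(2 * saddlePoint r t))
            * (1 + ε t)) ∧
      (∃ ε : ℝ → ℝ,
        ε =O[𝓝[>] (0 : ℝ)] (fun t => Real.log (Real.log (1 / t)) / Real.log (1 / t)) ∧
        ∀ᶠ t in 𝓝[>] (0 : ℝ),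
          f t = √(Real.exp 1) / (2 * π * besselI0 r)
            * (Real.log (1 / t) ^ (1 / 2 : ℝ) / t)
            * Real.exp (-t * saddlePoint r t + √(2 * saddlePoint r t))
            * (1 + ε t)) := by
  refine ⟨(eventually_isGreatest_saddleSolutions hr 0).mono fun t h => h.1,
    ⟨_, isHartmanWatsonDensity_hartmanWatsonDensity hr⟩, fun f hf => ?_⟩
  have hfeq := hf.eqOn (isHartmanWatsonDensity_hartmanWatsonDensity hr)
  have hI := besselI0_pos r
  have hp := pi_pos
  set ν : ℝ → ℝ := fun t => √(2 * saddlePoint r t) with hν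
  set a : ℝ → ℝ := fun t => Real.log (2 * ν t / r) with ha
  set T : ℝ → ℝ := fun t => √(rexp 1) / (π * besselI0 r) * (ν t / (2 * √(a t - 1))) *
    rexp (-t * (ν t ^ 2 / 2) + ν t) with hT
  set C := 7457 + r ^ 2 / 2
  have hsmall : ∀ᶠ t in 𝓝[>] (0 : ℝ), t ∈ Ioo (0 : ℝ) 1 := Ioo_mem_nhdsGT one_pos
  have hdata : ∀ᶠ t in 𝓝[>] (0 : ℝ), SaddleData r (a t) (ν t) t :=
    (eventually_saddleData hr 0).mono fun t h => h.1
  have huν : ∀ t, SaddleData r (a t) (ν t) t → saddlePoint r t = ν t ^ 2 / 2 := by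
    intro t h
    have h0 : 0 < √(2 * saddlePoint r t) := h.ν_pos
    rw [hν]
    simp only
    rw [Real.sq_sqrt (Real.sqrt_pos.1 h0).le]; ring
  have hTpos : ∀ t, SaddleData r (a t) (ν t) t → 0 < T t := by
    intro t h
    have := h.ν_pos
    have : 0 < √(a t - 1) := Real.sqrt_pos.2 (by linarith [h.a_ge])
    simp only [hT]
    positivity
  have hrel : ∀ t ∈ Ioo (0 : ℝ) 1, SaddleData r (a t) (ν t) t →
      |f t / T t - 1| ≤ C * √t := by
    intro t ht h
    obtain ⟨ε, hε, hfε⟩ := h.exists_relative_error ht.2.le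
    have hTt : hartmanWatsonDensity r t = T t * (1 + ε) := hfε
    rw [hfeq ht.1, hTt, mul_div_cancel_left₀ _ (hTpos t h).ne', add_sub_cancel_left]
    exact hε
  have hLT : Tendsto (fun t : ℝ => Real.log (1 / t)) (𝓝[>] 0) atTop := by
    simp only [one_div]
    exact Real.tendsto_log_atTop.comp tendsto_inv_nhdsGT_zero
  -- Both errors are defined as the quotient by the main term, minus one. The identities then need
  -- only a nonvanishing main term, and the content lies in the size bounds.
  refine ⟨⟨fun t => f t / T t - 1, ?_, ?_⟩, ⟨fun t => f t / (√(rexp 1) / (2 * π * besselI0 r) *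
    (Real.log (1 / t) ^ (1 / 2 : ℝ) / t) * rexp (-t * saddlePoint r t + ν t)) - 1, ?_, ?_⟩⟩
  · refine IsBigO.of_bound C ?_
    filter_upwards [hsmall, hdata, hLT.eventually_ge_atTop 1] with t ht h hL
    rw [Real.norm_eq_abs, Real.norm_of_nonneg (by positivity)]
    refine (hrel t ht h).trans ?_
    gcongr
    exact le_mul_of_one_le_right (Real.sqrt_nonneg t) (one_le_pow₀ hL)
  · filter_upwards [hdata] with t h
    have hT0 := (hTpos t h).ne'
    have e : √(rexp 1) / (π * besselI0 r)
        * √(saddlePoint r t / (Real.log (saddlePoint r t) - 2 - 2 * rhoParam r))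
        * rexp (-t * saddlePoint r t + ν t) = T t := by
      rw [huν t h, h.sqrt_quotient_eq]
    change f t = √(rexp 1) / (π * besselI0 r)
        * √(saddlePoint r t / (Real.log (saddlePoint r t) - 2 - 2 * rhoParam r))
        * rexp (-t * saddlePoint r t + ν t) * _
    rw [e, add_sub_cancel, mul_div_cancel₀ _ hT0]
  · set c := 1 / 2 + |Real.log (r / 2)| with hc
    have hlogL : Tendsto (fun t : ℝ => Real.log (Real.log (1 / t))) (𝓝[>] 0) atTop :=
      Real.tendsto_log_atTop.comp hLT
    have hm : ∀ᶠ m in atTop, Real.log m + c ≤ m / 2 := by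
      have h1 := (Real.isLittleO_log_id_atTop).bound (show (0 : ℝ) < 1 / 4 by norm_num)
      filter_upwards [h1, eventually_ge_atTop (4 * c), eventually_ge_atTop 0] with m h1 h2 h3
      rw [Real.norm_eq_abs, id, Real.norm_of_nonneg h3] at h1
      linarith [le_abs_self (Real.log m)]
    obtain ⟨A, hA⟩ := eventually_atTop.1 hm
    have hL2 : ∀ᶠ L in atTop, 3 * Real.log L + 2 ≤ L / 2 := by
      have h1 := (Real.isLittleO_log_id_atTop).bound (show (0 : ℝ) < 1 / 12 by norm_num)
      filter_upwards [h1, eventually_ge_atTop 8] with m h1 h2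
      rw [Real.norm_eq_abs, id, Real.norm_of_nonneg (by linarith)] at h1
      linarith [le_abs_self (Real.log m)]
    -- The quotient minus one is `(x - 1) κ + (κ - 1)`, where `|x - 1| ≤ C √t ≤ 2 C log L / L`, `|κ|
    -- ≤ 17` and `|κ - 1| ≤ 16 log L / L`.
    refine IsBigO.of_bound (34 * C + 16) ?_
    filter_upwards [hsmall, eventually_saddleData hr A, hlogL.eventually_ge_atTop (max 1 c),
      hLT.eventually hL2, hLT.eventually_gt_atTop 0] with t ht hh hl1 hl2 hl0
    have h : SaddleData r (a t) (ν t) t := hh.1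
    have hAa : A ≤ a t := hh.2
    set L := Real.log (1 / t) with hL
    have hlog1 : 1 ≤ Real.log L := (le_max_left _ _).trans hl1
    have hκ := h.abs_prefactor_ratio_sub_one_le hL hc (hA _ (hAa.trans h.a_le_t_mul_ν)) hlog1
      ((le_max_right _ _).trans hl1) hl2
    set κ := t * ν t / (√(a t - 1) * √L)
    have ht0 := ht.1
    have hν0 := h.ν_pos
    have ha1 : 0 < √(a t - 1) := Real.sqrt_pos.2 (by linarith [h.a_ge])
    have hsL : 0 < √L := Real.sqrt_pos.2 hl0
    have e : f t / (√(rexp 1) / (2 * π * besselI0 r) *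
        (L ^ (1 / 2 : ℝ) / t) * rexp (-t * saddlePoint r t + ν t)) = f t / T t * κ := by
      simp only [hT]
      rw [huν t h, ← Real.sqrt_eq_rpow]
      have : 0 < √(rexp 1) := Real.sqrt_pos.2 (Real.exp_pos 1)
      have := Real.exp_pos (-t * (ν t ^ 2 / 2) + ν t)
      simp only [κ]
      field_simp
    rw [e]
    have hr1 := hrel t ht h
    set x := f t / T t
    have hLL : 0 < Real.log L / L := by positivity
    have hst : √t ≤ 2 * (Real.log L / L) := by
      refine (sqrt_le_two_div_log ht0 hl0).trans ?_
      rw [← hL, mul_div_assoc']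
      gcongr; linarith
    have hLle : Real.log L / L ≤ 1 := by
      rw [div_le_one hl0]; linarith [Real.log_le_sub_one_of_pos hl0]
    have hκ17 : |κ| ≤ 17 := by
      have : |κ| ≤ |κ - 1| + |(1 : ℝ)| := by simpa using abs_add_le (κ - 1) 1
      rw [abs_one] at this
      linarith
    rw [Real.norm_eq_abs, Real.norm_of_nonneg hLL.le,
      show x * κ - 1 = (x - 1) * κ + (κ - 1) by ring]
    have hC : 0 ≤ C := by positivity
    calc _ ≤ |x - 1| * |κ| + |κ - 1| := by rw [← abs_mul]; exact abs_add_le _ _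
      _ ≤ C * (2 * (Real.log L / L)) * 17 + 16 * (Real.log L / L) := by
          gcongr
          exact hr1.trans (by gcongr)
      _ = _ := by ring
  · filter_upwards [hsmall, hdata, hLT.eventually_gt_atTop 0] with t ht h hL
    have ht0 := ht.1
    have hsL : 0 < Real.log (1 / t) ^ (1 / 2 : ℝ) := Real.rpow_pos_of_pos hL _
    have h0 : √(rexp 1) / (2 * π * besselI0 r) *
        (Real.log (1 / t) ^ (1 / 2 : ℝ) / t) * rexp (-t * saddlePoint r t + ν t) ≠ 0 := by
      have : 0 < √(rexp 1) := Real.sqrt_pos.2 (Real.exp_pos 1)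
      positivity
    change f t = √(rexp 1) / (2 * π * besselI0 r) *
        (Real.log (1 / t) ^ (1 / 2 : ℝ) / t) * rexp (-t * saddlePoint r t + ν t) * _
    rw [add_sub_cancel, mul_div_cancel₀ _ h0]
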